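/- All graphs are finite undirected multigraphs without loops; for a set $X$ write $X+a=X\cup\{a\}$ and $X-a=X\setminus\{a\}$. A graph is *bispanning* if its edge set is the union of two disjoint spanning trees; it is *atomic* if, in addition, its only bispanning subgraphs are itself and the one-vertex graphs. A graph is *simple* if it has no parallel edges. The vertex-connectivity is the greatest $k$ such that the graph is connected, has more than $k$ vertices, and remains connected after deleting any fewer than $k$ vertices. For a bispanning graph $G$ let $V_{\tau(G)}$ be the set of ordered pairs $(S,T)$ of disjoint spanning trees of $G$ with $S\cup T=E(G)$. For $(S,T)\in V_{\tau(G)}$ a pair $(e,f)\in S\times T$ is a *unique exchange* for $(S,T)$ if $f$ is the only edge of $T$ such that $(S-e+f,\;T+e-f)\in V_{\tau(G)}$; a pair $(e,f)\in T\times S$ is a unique exchange for $(S,T)$ if it is one for $(T,S)$. The directed multigraph $\vec\tau_3(G)$ has vertex set $V_{\tau(G)}$ and one arc $(e,f,S,T)$ for every $(S,T)\in V_{\tau(G)}$ and every unique exchange $(e,f)\in (S\times T)\cup(T\times S)$ for $(S,T)$; the arc leads from $(S,T)$ to $(S-e+f,\,T+e-f)$ if $e\in S$, and to $(S+e-f,\,T-e+f)$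 if $e\in T$. Let $G_1,G_2$ be graphs, $d_1$ an edge of $G_1$ and $d_2$ an edge of $G_2$. A *2-clique sum* $G_1\oplus_2G_2$ at $d_1,d_2$ is obtained from the disjoint union of $G_1$ and $G_2$ by identifying the ends of $d_1$ with the ends of $d_2$ (by one of the two bijections) and deleting $d_1$ and $d_2$. **Theorem.** Let $G$ be an atomic bispanning graph with vertex-connectivity $2$. Then $G$ is a 2-clique sum $G_1\oplus_2G_2$ of two simple bispanning graphs; and whenever $G\cong G_1\oplus_2G_2$ is a 2-clique sum of simple bispanning graphs $G_1,G_2$ at edges $d_1\in E(G_1)$, $d_2\in E(G_2)$, there is an isomorphism of directed multigraphs (bijections of vertices and of arcs that respect tails and heads) $$\vec\tau_3(G)\;\cong\;\eta_{d_1,d_2}\bigl(\vec\tau_3(G_1),\vec\tau_3(G_2)\bigr),$$ where the right-hand side is the following directed multigraph (the edge sets of $G_1$ and $G_2$ are taken disjoint). * Vertices: the pairs $((S_1,T_1),(S_2,T_2))\in V_{\tau(G_1)}\times V_{\tau(G_2)}$ such that neither ($d_1\in S_1$ and $d_2\in S_2$) nor ($d_1\in T_1$ and $d_2\in T_2$).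 * Arcs: the tuples $(e,f,(S_1,T_1),(S_2,T_2))$ where $((S_1,T_1),(S_2,T_2))$ is a vertex and one of the following holds: (a) $(e,f,S_1,T_1)$ is an arc of $\vec\tau_3(G_1)$ and $d_1\notin\{e,f\}$; (b) $(e,f,S_2,T_2)$ is an arc of $\vec\tau_3(G_2)$ and $d_2\notin\{e,f\}$; (c) $(e,d_1,S_1,T_1)$ is an arc of $\vec\tau_3(G_1)$ and $(d_2,f,S_2,T_2)$ is an arc of $\vec\tau_3(G_2)$; (d) $(e,d_2,S_2,T_2)$ is an arc of $\vec\tau_3(G_2)$ and $(d_1,f,S_1,T_1)$ is an arc of $\vec\tau_3(G_1)$. * Incidence: the tail of the arc is $((S_1,T_1),(S_2,T_2))$. Its head is obtained in case (a) by replacing $(S_1,T_1)$ by the head of $(e,f,S_1,T_1)$ in $\vec\tau_3(G_1)$; in case (b) by replacing $(S_2,T_2)$ by the head of $(e,f,S_2,T_2)$ in $\vec\tau_3(G_2)$; in cases (c) and (d) by replacing both $(S_1,T_1)$ and $(S_2,T_2)$ by the heads of the two named arcs of $\vec\tau_3(G_1)$ and $\vec\tau_3(G_2)$. -/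

import Mathlib

open scoped Graph

namespace Graph

section Basic

variable {α β : Type*}

/-- Any two vertices are joined by a path (and there is a vertex). Paths of a multigraph and of its
underlying simple graph join the same pairs of vertices. -/
def IsConnected (G : Graph α β) : Prop := G.toSimpleGraph.Connected

/-- A connected multigraph without cycles. A cycle of a multigraph is a loop, a pair of parallel
edges, or a cycle of length at least three of the underlying simple graph. -/
def IsTreeGraph (G : Graph α β) : Prop := G.Simple ∧ G.toSimpleGraph.IsTree

/-- The edge set `T` is a spanning tree: the graph `(V(G), T)` is a tree. -/
def IsSpanningTree (G : Graph α β) (T : Set β) : Prop :=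
  T ⊆ E(G) ∧ (G.restrict T).IsTreeGraph

/-- `S` and `T` are disjoint spanning trees whose union is the whole edge set. -/
def IsTreePair (G : Graph α β) (p : Set β × Set β) : Prop :=
  G.IsSpanningTree p.1 ∧ G.IsSpanningTree p.2 ∧ Disjoint p.1 p.2 ∧ p.1 ∪ p.2 = E(G)

theorem IsTreePair.swap {G : Graph α β} {p : Set β × Set β} (h : G.IsTreePair p) :
    G.IsTreePair p.swap :=
  ⟨h.2.1, h.1, h.2.2.1.symm, by rw [← h.2.2.2]; exact Set.union_comm _ _⟩

def IsBispanning (G : Graph α β) : Prop := ∃ p, G.IsTreePair p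

/-- A bispanning graph whose only bispanning subgraphs are itself and the one-vertex graphs. -/
def IsAtomicBispanning (G : Graph α β) : Prop :=
  G.IsBispanning ∧ ∀ H ≤ G, H.IsBispanning → H = G ∨ ∃ v, H = Graph.noEdge {v} β

def IsKVertexConnected (G : Graph α β) (k : ℕ) : Prop :=
  G.IsConnected ∧ (k : ℕ∞) < V(G).encard ∧
    ∀ X ⊆ V(G), X.encard < k → (G.deleteVerts X).IsConnected

/-- The vertex-connectivity of `G` is `k`. -/
def HasVertexConnectivity (G : Graph α β) (k : ℕ) : Prop :=
  IsGreatest {j | G.IsKVertexConnected j} k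

end Basic

section CliqueSum

variable {α β α₁ α₂ β₁ β₂ : Type*}

/-- An isomorphism of undirected multigraphs: bijections of the vertex sets and of the edge sets
that respect incidence. -/
structure MultiIso (G : Graph α₁ β₁) (H : Graph α₂ β₂) where
  vertexEquiv : V(G) ≃ V(H)
  edgeEquiv : E(G) ≃ E(H)
  isLink_iff : ∀ (e : E(G)) (x y : V(G)),
    G.IsLink e x y ↔ H.IsLink (edgeEquiv e) (vertexEquiv x) (vertexEquiv y)

/-- The union of disjoint copies of `G₁` and `G₂`. -/
def disjointUnion (G₁ : Graph α₁ β₁) (G₂ : Graph α₂ β₂) : Graph (α₁ ⊕ α₂) (β₁ ⊕ β₂) where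
  vertexSet := Sum.inl '' V(G₁) ∪ Sum.inr '' V(G₂)
  IsLink
    | .inl e, .inl x, .inl y => G₁.IsLink e x y
    | .inr e, .inr x, .inr y => G₂.IsLink e x y
    | _, _, _ => False
  isLink_symm := by
    rintro (e | e) - <;> constructor <;> rintro (x | x) (y | y) h <;>
      first | exact h.elim | exact IsLink.symm h
  eq_or_eq_of_isLink_of_isLink := by
    rintro (e | e) (x | x) (y | y) (v | v) (w | w) h h' <;>
      first | exact h.elim | exact h'.elim | simpa using IsLink.left_eq_or_eq h h'
  left_mem_of_isLink := by
    rintro (e | e) (x | x) (y | y) h <;>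
      first | exact h.elim | simpa using IsLink.left_mem h

open Classical in
/-- The map that contracts `{x₁, x₂}` and `{y₁, y₂}` in a disjoint union; the contracted vertices
are named after `x₁` and `y₁`. -/
noncomputable def glue (x₁ y₁ : α₁) (x₂ y₂ : α₂) : α₁ ⊕ α₂ → α₁ ⊕ α₂
  | .inl v => .inl v
  | .inr v => if v = x₂ then .inl x₁ else if v = y₂ then .inl y₁ else .inr v

/-- The `2`-clique sum at the edges `d₁` (with ends `x₁, y₁`) and `d₂` (with ends `x₂, y₂`), where
`x₁` is identified with `x₂` and `y₁` with `y₂`, and neither `d₁` nor `d₂` is kept. -/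
noncomputable def twoCliqueSum (G₁ : Graph α₁ β₁) (G₂ : Graph α₂ β₂) (d₁ : β₁) (d₂ : β₂)
    (x₁ y₁ : α₁) (x₂ y₂ : α₂) : Graph (α₁ ⊕ α₂) (β₁ ⊕ β₂) :=
  ((disjointUnion G₁ G₂).map (glue x₁ y₁ x₂ y₂)).deleteEdges {.inl d₁, .inr d₂}

/-- `G` is (isomorphic to) a `2`-clique sum of `G₁` and `G₂` at the edges `d₁` and `d₂`, without
remaining edges. -/
def IsTwoCliqueSum (G : Graph α β) (G₁ : Graph α₁ β₁) (G₂ : Graph α₂ β₂) (d₁ : β₁) (d₂ : β₂) :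
    Prop :=
  ∃ x₁ y₁ x₂ y₂, G₁.IsLink d₁ x₁ y₁ ∧ G₂.IsLink d₂ x₂ y₂ ∧
    Nonempty (MultiIso G (twoCliqueSum G₁ G₂ d₁ d₂ x₁ y₁ x₂ y₂))

end CliqueSum

end Graph

/-- A directed graph with a set of arcs and an incidence function (tail, head). -/
structure DirectedMultigraph where
  Vert : Type*
  Arc : Type*
  inc : Arc → Vert × Vert

/-- An isomorphism of directed graphs: bijections of vertices and of arcs respecting incidence. -/
structure DirectedMultigraph.Iso (D D' : DirectedMultigraph) where
  vertEquiv : D.Vert ≃ D'.Vert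
  arcEquiv : D.Arc ≃ D'.Arc
  inc_eq : ∀ a, D'.inc (arcEquiv a) = Prod.map vertEquiv vertEquiv (D.inc a)

namespace Graph

section Exchange

variable {α β : Type*}

/-- `(e, f) ∈ S × T` is a unique exchange: `f` is the only edge of `T` such that exchanging `e` and
`f` gives disjoint spanning trees `(S - e + f, T + e - f)` again. -/
def IsUniqueExchange (G : Graph α β) (S T : Set β) (e f : β) : Prop :=
  e ∈ S ∧ f ∈ T ∧ G.IsTreePair (insert f (S \ {e}), insert e T \ {f}) ∧
    ∀ g ∈ T, G.IsTreePair (insert g (S \ {e}), insert e T \ {g}) → g = f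

/-- The vertices of the exchange graph: the ordered pairs of disjoint spanning trees. -/
def TreePair (G : Graph α β) : Type _ := {p : Set β × Set β // G.IsTreePair p}

/-- `(e, f, S, T)` is an arc of the directed unique exchange graph, where `p = (S, T)`. -/
def IsTauThreeArc (G : Graph α β) (e f : β) (p : G.TreePair) : Prop :=
  G.IsUniqueExchange p.1.1 p.1.2 e f ∨ G.IsUniqueExchange p.1.2 p.1.1 e f

open Classical in
/-- `(S - e + f, T + e - f)` if `e ∈ S`, and `(S + e - f, T - e + f)` otherwise. -/
noncomputable def exchangePair (e f : β) (p : Set β × Set β) : Set β × Set β :=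
  if e ∈ p.1 then (insert f (p.1 \ {e}), insert e p.2 \ {f})
  else (insert e p.1 \ {f}, insert f (p.2 \ {e}))

theorem IsTauThreeArc.isTreePair {G : Graph α β} {e f : β} {p : G.TreePair}
    (h : G.IsTauThreeArc e f p) : G.IsTreePair (exchangePair e f p.1) := by
  rcases h with h | h
  · rw [exchangePair, if_pos h.1]
    exact h.2.2.1
  · rw [exchangePair, if_neg (Set.disjoint_right.1 p.2.2.2.1 h.1)]
    exact h.2.2.1.swap

/-- The tree pair reached from `p` along the arc `(e, f, p)`. -/
noncomputable def IsTauThreeArc.head {G : Graph α β} {e f : β} {p : G.TreePair}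
    (h : G.IsTauThreeArc e f p) : G.TreePair :=
  ⟨exchangePair e f p.1, h.isTreePair⟩

/-- The directed unique exchange graph. -/
noncomputable def tauThree (G : Graph α β) : DirectedMultigraph where
  Vert := G.TreePair
  Arc := {a : β × β × G.TreePair // G.IsTauThreeArc a.1 a.2.1 a.2.2}
  inc a := (a.1.2.2, a.2.head)

theorem IsTauThreeArc.mem_head_of_ne {G : Graph α β} {e f : β} {p : G.TreePair}
    (h : G.IsTauThreeArc e f p) {d : β} (he : e ≠ d) (hf : f ≠ d) :
    (d ∈ h.head.1.1 ↔ d ∈ p.1.1) ∧ (d ∈ h.head.1.2 ↔ d ∈ p.1.2) := by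
  have he' := he.symm
  have hf' := hf.symm
  by_cases hp : e ∈ p.1.1 <;> simp [IsTauThreeArc.head, exchangePair, hp, he', hf']

theorem IsTauThreeArc.mem_head_of_mem {G : Graph α β} {e f : β} {p : G.TreePair}
    (h : G.IsTauThreeArc e f p) {d : β} (hd : d = e ∨ d = f) :
    (d ∈ h.head.1.1 ↔ d ∈ p.1.2) ∧ (d ∈ h.head.1.2 ↔ d ∈ p.1.1) := by
  have hdis := Set.disjoint_left.1 p.2.2.2.1
  rcases h with h | h <;> have h1 := h.1 <;> have h2 := h.2.1
  · have hne : e ≠ f := fun hef => hdis h1 (hef ▸ h2)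
    rcases hd with rfl | rfl
    · simp [IsTauThreeArc.head, exchangePair, h1, hne, hdis h1]
    · have : d ∉ p.1.1 := fun hh => hdis hh h2
      simp [IsTauThreeArc.head, exchangePair, h1, h2, this]
  · have hne : e ≠ f := fun hef => hdis (hef ▸ h2) h1
    have h3 : e ∉ p.1.1 := fun hh => hdis hh h1
    rcases hd with rfl | rfl
    · simp [IsTauThreeArc.head, exchangePair, h1, h3, hne]
    · simp [IsTauThreeArc.head, exchangePair, h3, h2, hdis h2]

end Exchange

section Join

variable {α₁ α₂ β₁ β₂ : Type*}

/-- The condition on `((S₁, T₁), (S₂, T₂))` to be a vertex of the join: not both seam edges in the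
first trees, and not both in the second trees. -/
def SeamSplit (d₁ : β₁) (d₂ : β₂) (p₁ : Set β₁ × Set β₁) (p₂ : Set β₂ × Set β₂) : Prop :=
  ¬ ((d₁ ∈ p₁.1 ∧ d₂ ∈ p₂.1) ∨ (d₁ ∈ p₁.2 ∧ d₂ ∈ p₂.2))

/-- The vertices of the join of the exchange graphs of `G₁` and `G₂` at `d₁` and `d₂`. -/
def JoinVert (G₁ : Graph α₁ β₁) (G₂ : Graph α₂ β₂) (d₁ : β₁) (d₂ : β₂) : Type _ :=
  {q : G₁.TreePair × G₂.TreePair // SeamSplit d₁ d₂ q.1.1 q.2.1}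

/-- `(e, f, q)` is an arc of the join: an exchange in `G₁` or in `G₂` that avoids the seam edge, or
a chain of two exchanges through the seam. -/
def IsJoinArc {G₁ : Graph α₁ β₁} {G₂ : Graph α₂ β₂} (d₁ : β₁) (d₂ : β₂)
    (q : G₁.TreePair × G₂.TreePair) : β₁ ⊕ β₂ → β₁ ⊕ β₂ → Prop
  | .inl e, .inl f => G₁.IsTauThreeArc e f q.1 ∧ ¬ (e = d₁ ∨ f = d₁)
  | .inr e, .inr f => G₂.IsTauThreeArc e f q.2 ∧ ¬ (e = d₂ ∨ f = d₂)
  | .inl e, .inr f => G₁.IsTauThreeArc e d₁ q.1 ∧ G₂.IsTauThreeArc d₂ f q.2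
  | .inr e, .inl f => G₂.IsTauThreeArc e d₂ q.2 ∧ G₁.IsTauThreeArc d₁ f q.1

/-- The end of an arc of the join: the exchange is carried out in the graph that contains `e` and
`f`; if they lie in different graphs, both chained exchanges are carried out. -/
noncomputable def joinHead {G₁ : Graph α₁ β₁} {G₂ : Graph α₂ β₂} {d₁ : β₁} {d₂ : β₂}
    (q : JoinVert G₁ G₂ d₁ d₂) :
    (e f : β₁ ⊕ β₂) → IsJoinArc d₁ d₂ q.1 e f → JoinVert G₁ G₂ d₁ d₂
  | .inl _, .inl _, h => ⟨(h.1.head, q.1.2), by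
      have hm := h.1.mem_head_of_ne (fun hh => h.2 (.inl hh)) (fun hh => h.2 (.inr hh))
      have hq := q.2
      simp only [SeamSplit] at hq ⊢
      rwa [hm.1, hm.2]⟩
  | .inr _, .inr _, h => ⟨(q.1.1, h.1.head), by
      have hm := h.1.mem_head_of_ne (fun hh => h.2 (.inl hh)) (fun hh => h.2 (.inr hh))
      have hq := q.2
      simp only [SeamSplit] at hq ⊢
      rwa [hm.1, hm.2]⟩
  | .inl _, .inr _, h => ⟨(h.1.head, h.2.head), by
      have hm := h.1.mem_head_of_mem (.inr rfl)
      have hm' := h.2.mem_head_of_mem (.inl rfl)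
      have hq := q.2
      simp only [SeamSplit] at hq ⊢
      rwa [hm.1, hm.2, hm'.1, hm'.2, or_comm]⟩
  | .inr _, .inl _, h => ⟨(h.2.head, h.1.head), by
      have hm := h.2.mem_head_of_mem (.inl rfl)
      have hm' := h.1.mem_head_of_mem (.inr rfl)
      have hq := q.2
      simp only [SeamSplit] at hq ⊢
      rwa [hm.1, hm.2, hm'.1, hm'.2, or_comm]⟩

/-- The join of the directed unique exchange graphs of `G₁` and `G₂` at the seam edges `d₁`, `d₂`. -/
noncomputable def tauThreeJoin (G₁ : Graph α₁ β₁) (G₂ : Graph α₂ β₂) (d₁ : β₁) (d₂ : β₂) :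
    DirectedMultigraph where
  Vert := JoinVert G₁ G₂ d₁ d₂
  Arc := {a : (β₁ ⊕ β₂) × (β₁ ⊕ β₂) × JoinVert G₁ G₂ d₁ d₂ //
    IsJoinArc d₁ d₂ a.2.2.1 a.1 a.2.1}
  inc a := (a.1.2.2, joinHead a.1.2.2 a.1.1 a.1.2.1 a.2)

end Join

end Graph

/-!
An edge set of a 2-clique sum `G` is a spanning tree iff it is a spanning tree of one summand on one
side of the seam and becomes a spanning tree of the other summand, on the other side, once the seam
edge is added. Two disjoint spanning trees covering `G` therefore come from a pair of such trees in
each summand, with the two seam edges in opposite trees. The alternative, that both trees restrict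
to spanning trees of the same summand `Gᵢ`, would make `Gᵢ - dᵢ` bispanning as well as `Gᵢ`, which
the number of edges excludes.

An exchange between two edges of one summand is an exchange of that summand which avoids the seam
edge; an exchange between edges of different summands is a pair of exchanges of the summands chained
through the seam edges. Every edge has an exchange partner, so an exchange in one summand that
involves the seam edge can always be completed in the other one, and uniqueness transfers in both
directions.

For the decomposition, a bispanning graph on three vertices has parallel edges, so an atomic graph
of connectivity 2 has a cut pair. Splitting there and adding a new edge between the cut vertices to
both sides exhibits the graph as a 2-clique sum. The same dichotomy for pairs of trees then makes
the two new graphs bispanning, because a proper side of an atomic graph is not bispanning; and an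
old edge between the cut vertices could replace the new one, making a proper side bispanning.
-/

namespace Bispanning

open Graph

section Reach

variable {α β γ δ : Type*} {G : Graph α β} {K : Graph γ δ} {U W : Set β} {X : Set δ} {e : β}
  {x y z u v : α}

/-- `Reach G U x y`: some walk of `G` all of whose edges lie in `U` leads from `x` to `y`. -/
def Reach (G : Graph α β) (U : Set β) : α → α → Prop :=
  Relation.ReflTransGen fun a b => ∃ e ∈ U, G.IsLink e a b

theorem Reach.refl (G : Graph α β) (U : Set β) (x : α) : Reach G U x x :=
  Relation.ReflTransGen.refl

theorem Reach.trans (h : Reach G U x y) (h' : Reach G U y z) : Reach G U x z :=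
  Relation.ReflTransGen.trans h h'

theorem reach_of_isLink (h : G.IsLink e x y) (he : e ∈ U) : Reach G U x y :=
  Relation.ReflTransGen.single ⟨e, he, h⟩

theorem Reach.symm (h : Reach G U x y) : Reach G U y x := by
  have : Std.Symm fun a b => ∃ e ∈ U, G.IsLink e a b :=
    ⟨fun _ _ ⟨e, he, hl⟩ => ⟨e, he, hl.symm⟩⟩
  exact Relation.ReflTransGen.stdSymm.symm _ _ h

theorem Reach.map (φ : α → γ) (hφ : ∀ e ∈ U, ∀ a b, G.IsLink e a b → Reach K X (φ a) (φ b))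
    (h : Reach G U x y) : Reach K X (φ x) (φ y) :=
  Relation.ReflTransGen.lift' φ (fun a b ⟨e, he, hl⟩ => hφ e he a b hl) x y h

theorem Reach.mono (hUW : U ⊆ W) (h : Reach G U x y) : Reach G W x y :=
  h.map id fun _ he _ _ hl => reach_of_isLink hl (hUW he)

theorem Reach.of_sdiff (h : Reach G U x y) (hl : G.IsLink e u v) (hUW : U \ {e} ⊆ W)
    (huv : Reach G W u v) : Reach G W x y := by
  refine h.map id fun f hf a b hab => ?_
  by_cases hfe : f = e
  · subst hfe
    obtain ⟨rfl, rfl⟩ | ⟨rfl, rfl⟩ := hl.eq_and_eq_or_eq_and_eq hab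
    exacts [huv, huv.symm]
  · exact reach_of_isLink hab (hUW ⟨hf, hfe⟩)

theorem Reach.right_mem (h : Reach G U x y) (hx : x ∈ V(G)) : y ∈ V(G) := by
  induction h with
  | refl => exact hx
  | tail _ h _ => exact h.choose_spec.2.right_mem

theorem Reach.insert_cases (h : Reach G (insert e U) x y) (hl : G.IsLink e u v) :
    Reach G U x y ∨ (Reach G U x u ∧ Reach G U v y) ∨ (Reach G U x v ∧ Reach G U u y) := by
  induction h with
  | refl => exact .inl (.refl _ _ _)
  | tail _ h ih =>
    obtain ⟨f, rfl | hf, h⟩ := h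
    · obtain ⟨rfl, rfl⟩ | ⟨rfl, rfl⟩ := hl.eq_and_eq_or_eq_and_eq h
      · rcases ih with ih | ih | ih
        exacts [.inr (.inl ⟨ih, .refl _ _ _⟩), .inr (.inl ⟨ih.1, .refl _ _ _⟩), .inl ih.1]
      · rcases ih with ih | ih | ih
        exacts [.inr (.inr ⟨ih, .refl _ _ _⟩), .inl ih.1, .inr (.inr ⟨ih.1, .refl _ _ _⟩)]
    · have hr := reach_of_isLink h hf
      exact ih.imp (·.trans hr) (.imp (.imp_right (·.trans hr)) (.imp_right (·.trans hr)))

theorem Reach.of_insert (h : Reach G (insert e U) x y) (hl : G.IsLink e u v) (hUW : U ⊆ W)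
    (hxy : ¬ Reach G U x y) (hW : Reach G W x y) : Reach G W u v := by
  rcases h.insert_cases hl with h | ⟨hxu, hvy⟩ | ⟨hxv, huy⟩
  · exact absurd h hxy
  · exact (hxu.mono hUW).symm.trans (hW.trans (hvy.mono hUW).symm)
  · exact (huy.mono hUW).trans (hW.symm.trans (hxv.mono hUW))

theorem Reach.exists_finset (h : Reach G U x y) : ∃ F : Finset β, ↑F ⊆ U ∧ Reach G F x y := by
  classical
  induction h with
  | refl => exact ⟨∅, by simp, .refl _ _ _⟩
  | tail _ h ih =>
    obtain ⟨e, he, h⟩ := h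
    obtain ⟨F, hF, hr⟩ := ih
    exact ⟨insert e F, by simp [Set.insert_subset_iff, he, hF],
      (hr.mono (by simp)).trans (reach_of_isLink h (by simp))⟩

theorem Reach.exists_isLink_of_not (h : Reach G U x y) (P : α → Prop) (hx : P x) (hy : ¬ P y) :
    ∃ f ∈ U, ∃ u v, G.IsLink f u v ∧ P u ∧ ¬ P v := by
  by_contra! hc
  have hP : Relation.ReflTransGen (fun a b => P a → P b) x y :=
    Relation.ReflTransGen.mono (fun a b ⟨e, he, hl⟩ => hc e he a b hl) _ _ h
  clear h
  induction hP with
  | refl => exact hy hx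
  | tail _ h ih => exact ih fun hb => hy (h hb)

/-- The edge `f` is taken from a shortest walk, which it cuts into two pieces that avoid it. -/
theorem Reach.exists_isLink_of_not_cut (h : Reach G U x y) (P : α → Prop) (hx : P x)
    (hy : ¬ P y) : ∃ f ∈ U, ∃ u v, G.IsLink f u v ∧ P u ∧ ¬ P v ∧
      ∀ W, U \ {f} ⊆ W → Reach G W x y → Reach G W u v := by
  classical
  obtain ⟨F, hFU, hF⟩ := h.exists_finset
  induction F using Finset.strongInduction with
  | H F ih =>
    obtain ⟨f, hf, u, v, hl, hu, hv⟩ := hF.exists_isLink_of_not P hx hy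
    by_cases hr : Reach G (F.erase f : Finset β) x y
    · exact ih _ (Finset.erase_ssubset hf)
        ((Finset.coe_subset.2 (Finset.erase_subset _ _)).trans hFU) hr
    · refine ⟨f, hFU hf, u, v, hl, hu, hv, fun W hW => Reach.of_insert ?_ hl ?_ hr⟩
      · rwa [← Finset.coe_insert, Finset.insert_erase hf]
      · exact (Finset.coe_erase f F ▸ Set.sdiff_subset_sdiff_left hFU).trans hW

end Reach

section Connects

variable {α β γ δ : Type*} {G : Graph α β} {K : Graph γ δ} {U W S T : Set β} {X : Set δ}
  {e f : β} {x y z u v : α}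

/-- `Connects G U`: the graph `(V(G), U)` is connected; elements of `U` outside `E(G)` are
ignored. -/
def Connects (G : Graph α β) (U : Set β) : Prop :=
  V(G).Nonempty ∧ ∀ x ∈ V(G), ∀ y ∈ V(G), Reach G U x y

theorem Connects.map (h : Connects G U) (φ : α → γ) (hK : V(K).Nonempty)
    (hV : ∀ v ∈ V(K), ∃ a ∈ V(G), Reach K X (φ a) v)
    (hφ : ∀ e ∈ U, ∀ a b, G.IsLink e a b → Reach K X (φ a) (φ b)) : Connects K X := by
  refine ⟨hK, fun x hx y hy => ?_⟩
  obtain ⟨a, ha, hax⟩ := hV x hx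
  obtain ⟨b, hb, hby⟩ := hV y hy
  exact hax.symm.trans (((h.2 a ha b hb).map φ hφ).trans hby)

theorem Connects.mono (hUW : U ⊆ W) (h : Connects G U) : Connects G W :=
  ⟨h.1, fun x hx y hy => (h.2 x hx y hy).mono hUW⟩

theorem Connects.inter_edgeSet (h : Connects G U) : Connects G (U ∩ E(G)) :=
  h.map id h.1 (fun v hv => ⟨v, hv, .refl _ _ _⟩) fun _ he _ _ hl =>
    reach_of_isLink hl ⟨he, hl.edge_mem⟩

theorem Connects.of_sdiff (h : Connects G U) (hl : G.IsLink e u v) (hUW : U \ {e} ⊆ W)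
    (huv : Reach G W u v) : Connects G W :=
  ⟨h.1, fun x hx y hy => (h.2 x hx y hy).of_sdiff hl hUW huv⟩

theorem minimal_connects_iff :
    Minimal (Connects G) T ↔ Connects G T ∧ ∀ e ∈ T, ¬ Connects G (T \ {e}) :=
  Set.minimal_iff_forall_sdiff_singleton fun _ _ h hTU => h.mono hTU

theorem subset_edgeSet_of_minimal_connects (h : Minimal (Connects G) T) : T ⊆ E(G) :=
  (h.le_of_le h.prop.inter_edgeSet Set.inter_subset_left).trans Set.inter_subset_right

theorem not_reach_of_minimal_connects (h : Minimal (Connects G) T) (he : e ∈ T)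
    (hl : G.IsLink e x y) : ¬ Reach G (T \ {e}) x y :=
  fun hr => (minimal_connects_iff.1 h).2 e he (h.prop.of_sdiff hl subset_rfl hr)

theorem minimal_connects_insert_sdiff (h : Minimal (Connects G) T) (hf : f ∈ T)
    (hl : G.IsLink e x y) (hc : Connects G (insert e (T \ {f}))) :
    Minimal (Connects G) (insert e (T \ {f})) := by
  obtain ⟨u, v, huv⟩ := exists_isLink_of_mem_edgeSet (subset_edgeSet_of_minimal_connects h hf)
  have hnr := not_reach_of_minimal_connects h hf huv
  refine minimal_connects_iff.2 ⟨hc, ?_⟩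
  rintro g (rfl | hg) hcon
  · exact hnr ((hcon.2 u huv.left_mem v huv.right_mem).mono (by grind))
  · have hr : Reach G (insert e ((T \ {f}) \ {g})) u v :=
      (hcon.2 u huv.left_mem v huv.right_mem).mono (by grind)
    have hfg : f ∈ T \ {g} := ⟨hf, fun hfg => hg.2 hfg.symm⟩
    have hxy : Reach G (T \ {g}) x y :=
      hr.of_insert hl (by grind) (fun hr => hnr (hr.mono (by grind))) (reach_of_isLink huv hfg)
    exact (minimal_connects_iff.1 h).2 g hg.1 (hcon.of_sdiff hl (by grind) hxy)

theorem reach_or_reach_of_minimal_connects (h : Minimal (Connects G) T) (hl : G.IsLink e x y)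
    (hz : z ∈ V(G)) : Reach G (T \ {e}) x z ∨ Reach G (T \ {e}) y z := by
  have hr : Reach G (insert e (T \ {e})) x z := (h.prop.2 x hl.left_mem z hz).mono (by simp)
  rcases hr.insert_cases hl with hr | hr | hr
  exacts [.inl hr, .inr hr.2, .inl hr.2]

/-- `f` is taken from the path in `T` between the ends of `e`, where that path crosses between the
two components of `S \ {e}`. -/
theorem exists_symm_exchange_of_minimal_connects (hS : Minimal (Connects G) S)
    (hT : Minimal (Connects G) T) (he : e ∈ S) :
    ∃ f ∈ T, f ∉ S \ {e} ∧ Minimal (Connects G) (insert f (S \ {e})) ∧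
      Minimal (Connects G) (insert e (T \ {f})) := by
  obtain ⟨x, y, hxy⟩ := exists_isLink_of_mem_edgeSet (subset_edgeSet_of_minimal_connects hS he)
  have hT' := hT.prop.2 x hxy.left_mem y hxy.right_mem
  obtain ⟨f, hf, u, v, huv, hxu, hxv, hcut⟩ := hT'.exists_isLink_of_not_cut
    (Reach G (S \ {e}) x) (.refl _ _ _) (not_reach_of_minimal_connects hS he hxy)
  have hyv := (reach_or_reach_of_minimal_connects hS hxy huv.right_mem).resolve_left hxv
  refine ⟨f, hf, fun hfS => hxv (hxu.trans (reach_of_isLink huv hfS)),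
    minimal_connects_insert_sdiff hS he huv (hS.prop.of_sdiff hxy (Set.subset_insert _ _) ?_),
    minimal_connects_insert_sdiff hT hf hxy (hT.prop.of_sdiff huv (Set.subset_insert _ _) ?_)⟩
  · have hs : S \ {e} ⊆ insert f (S \ {e}) := Set.subset_insert _ _
    exact (hxu.mono hs).trans ((reach_of_isLink huv (Set.mem_insert _ _)).trans (hyv.mono hs).symm)
  · exact hcut _ (Set.subset_insert _ _) (reach_of_isLink hxy (Set.mem_insert _ _))

theorem reach_iff_reachable (x y : V(G.restrict U)) :
    Reach G U x y ↔ (G.restrict U).toSimpleGraph.Reachable x y := by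
  rw [SimpleGraph.reachable_iff_reflTransGen]
  constructor
  · intro h
    obtain ⟨y, hy⟩ := y
    change Reach G U x y at h
    induction h with
    | refl => exact .refl
    | @tail b c _ h ih =>
      obtain ⟨e, he, hl⟩ := h
      obtain rfl | hbc := eq_or_ne b c
      · exact ih _
      · exact (ih hl.left_mem).tail ⟨fun h => hbc (congrArg Subtype.val h), e, he, hl⟩
  · exact Relation.ReflTransGen.lift Subtype.val (fun _ _ ⟨_, e, he, hl⟩ => ⟨e, he, hl⟩) x y

theorem connects_iff_connected : Connects G U ↔ (G.restrict U).toSimpleGraph.Connected := by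
  rw [SimpleGraph.connected_iff]
  exact ⟨fun h => ⟨fun x y => (reach_iff_reachable x y).1 (h.2 x x.2 y y.2),
      Set.nonempty_coe_sort.2 h.1⟩,
    fun h => ⟨Set.nonempty_coe_sort.1 h.2,
      fun x hx y hy => (reach_iff_reachable ⟨x, hx⟩ ⟨y, hy⟩).2 (h.1 _ _)⟩⟩

theorem isConnected_iff_connects : G.IsConnected ↔ Connects G E(G) := by
  rw [connects_iff_connected, restrict_self, Graph.IsConnected]

theorem toSimpleGraph_restrict_sdiff_singleton [(G.restrict T).Simple] (he : e ∈ T)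
    {x y : V(G.restrict T)} (hl : G.IsLink e x y) : (G.restrict (T \ {e})).toSimpleGraph =
      (G.restrict T).toSimpleGraph \ SimpleGraph.fromEdgeSet {s(x, y)} := by
  have hl' : (G.restrict T).IsLink e x y := ⟨he, hl⟩
  ext a b
  constructor
  · rintro ⟨hab, f, hf, hfl⟩
    refine ⟨⟨hab, f, hf.1, hfl⟩, fun hs => hf.2 ?_⟩
    have hfl' : (G.restrict T).IsLink f a b := ⟨hf.1, hfl⟩
    have hs' : s(a, b) = s(x, y) := hs.1
    rcases Sym2.eq_iff.1 hs' with ⟨rfl, rfl⟩ | ⟨rfl, rfl⟩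
    exacts [hfl'.eq hl', hfl'.symm.eq hl']
  · rintro ⟨⟨hab, f, hf, hfl⟩, hs⟩
    refine ⟨hab, f, ⟨hf, ?_⟩, hfl⟩
    rintro rfl
    refine hs ⟨Sym2.eq_iff.2 ?_, hab⟩
    exact (hl.eq_and_eq_or_eq_and_eq hfl).imp
      (fun h => ⟨Subtype.ext h.1.symm, Subtype.ext h.2.symm⟩) fun h =>
        ⟨Subtype.ext h.2.symm, Subtype.ext h.1.symm⟩

theorem isAcyclic_restrict_iff [(G.restrict T).Simple] :
    (G.restrict T).toSimpleGraph.IsAcyclic ↔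
      ∀ e ∈ T, ∀ x y, G.IsLink e x y → ¬ Reach G (T \ {e}) x y := by
  rw [SimpleGraph.isAcyclic_iff_forall_adj_isBridge]
  have hbridge {e : β} (he : e ∈ T) {x y : V(G.restrict T)} (hl : G.IsLink e x y) :
      (G.restrict T).toSimpleGraph.IsBridge s(x, y) ↔ ¬ Reach G (T \ {e}) x y := by
    have hr := reach_iff_reachable (U := T \ {e}) x y
    rw [toSimpleGraph_restrict_sdiff_singleton he hl] at hr
    exact SimpleGraph.isBridge_iff.trans hr.not.symm
  constructor
  · intro h e he x y hl
    have hne : x ≠ y := (show (G.restrict T).IsLink e x y from ⟨he, hl⟩).ne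
    exact (hbridge he (x := ⟨x, hl.left_mem⟩) (y := ⟨y, hl.right_mem⟩) hl).1
      (h ⟨fun h => hne (congrArg Subtype.val h), e, he, hl⟩)
  · rintro h x y ⟨-, e, he, hl⟩
    exact (hbridge he hl).2 (h e he x y hl)

theorem simple_restrict_of_minimal_connects (h : Minimal (Connects G) T) :
    (G.restrict T).Simple where
  not_isLoopAt _ _ hl := not_reach_of_minimal_connects h hl.1 hl.2 (.refl _ _ _)
  eq_of_isLink e f _ _ he hf := by
    by_contra hne
    exact not_reach_of_minimal_connects h he.1 he.2
      (reach_of_isLink hf.2 ⟨hf.1, fun hfe => hne hfe.symm⟩)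

theorem isSpanningTree_iff_minimal_connects :
    G.IsSpanningTree T ↔ Minimal (Connects G) T := by
  constructor
  · rintro ⟨hTE, hs, hT⟩
    refine minimal_connects_iff.2 ⟨connects_iff_connected.2 hT.1, fun e he hc => ?_⟩
    obtain ⟨x, y, hl⟩ := exists_isLink_of_mem_edgeSet (hTE he)
    exact isAcyclic_restrict_iff.1 hT.2 e he x y hl (hc.2 x hl.left_mem y hl.right_mem)
  · intro h
    have hs := simple_restrict_of_minimal_connects h
    exact ⟨subset_edgeSet_of_minimal_connects h, hs, connects_iff_connected.1 h.prop,
      isAcyclic_restrict_iff.2 fun e he x y => not_reach_of_minimal_connects h he⟩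

end Connects

section SpanningTree

variable {α β : Type*} {G : Graph α β} {F T : Set β} {p : Set β × Set β} {d e f : β} {x y : α}

theorem exchangeProperty_isSpanningTree (G : Graph α β) :
    Matroid.ExchangeProperty G.IsSpanningTree := by
  rintro S T hS hT e ⟨heS, heT⟩
  rw [isSpanningTree_iff_minimal_connects] at hS hT
  obtain ⟨f, hfT, hfS, hf, -⟩ := exists_symm_exchange_of_minimal_connects hS hT heS
  exact ⟨f, ⟨hfT, fun h => hfS ⟨h, fun hfe => heT (hfe ▸ hfT)⟩⟩,
    isSpanningTree_iff_minimal_connects.2 hf⟩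

theorem ne_of_isLink_of_isSpanningTree (hT : G.IsSpanningTree T) (he : e ∈ T)
    (hl : G.IsLink e x y) : x ≠ y := by
  rintro rfl
  exact not_reach_of_minimal_connects (isSpanningTree_iff_minimal_connects.1 hT) he hl
    (.refl _ _ _)

theorem ne_of_isLink_of_isBispanning (hG : G.IsBispanning) (hl : G.IsLink e x y) : x ≠ y := by
  obtain ⟨p, hS, hT, -, hE⟩ := hG
  rcases hE.ge hl.edge_mem with he | he
  exacts [ne_of_isLink_of_isSpanningTree hS he hl, ne_of_isLink_of_isSpanningTree hT he hl]

theorem isSpanningTree_deleteEdges_iff :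
    (G.deleteEdges F).IsSpanningTree T ↔ G.IsSpanningTree T ∧ Disjoint T F := by
  have hrestrict (hT : Disjoint T F) : (G.deleteEdges F).restrict T = G.restrict T := by
    rw [← restrict_edgeSet_sdiff_eq_deleteEdges, restrict_restrict,
      ← restrict_inter_edgeSet, ← G.restrict_inter_edgeSet T]
    congr 1
    grind
  rw [Graph.IsSpanningTree, edgeSet_deleteEdges, Set.subset_sdiff, and_assoc, Graph.IsSpanningTree,
    and_assoc]
  exact and_congr_right fun _ =>
    ⟨fun h => ⟨hrestrict h.1 ▸ h.2, h.1⟩, fun h => ⟨h.2, (hrestrict h.2).symm ▸ h.1⟩⟩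

theorem isSpanningTree_deleteEdges_singleton_iff :
    (G.deleteEdges {d}).IsSpanningTree T ↔ G.IsSpanningTree T ∧ d ∉ T := by
  rw [isSpanningTree_deleteEdges_iff, Set.disjoint_singleton_right]

theorem not_isBispanning_deleteEdges_singleton (hE : E(G).Finite) (hG : G.IsBispanning)
    (hd : d ∈ E(G)) : ¬ (G.deleteEdges {d}).IsBispanning := by
  obtain ⟨p, hp₁, hp₂, hp, hpE⟩ := hG
  rintro ⟨q, hq₁, hq₂, hq, hqE⟩
  rw [isSpanningTree_deleteEdges_singleton_iff] at hq₁ hq₂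
  have encard_eq {S T : Set β} (hS : G.IsSpanningTree S) (hT : G.IsSpanningTree T) :
      S.encard = T.encard := (exchangeProperty_isSpanningTree G).encard_isBase_eq hS hT
  have hcard : (E(G) \ {d}).encard = E(G).encard := by
    rw [← edgeSet_deleteEdges, ← hqE, ← hpE, Set.encard_union_eq hq, Set.encard_union_eq hp,
      encard_eq hq₁.1 hp₁, encard_eq hq₂.1 hp₂]
  exact (hE.sdiff.encard_lt_encard (Set.sdiff_singleton_ssubset.2 hd)).ne hcard

end SpanningTree

section Exchange

variable {α β : Type*} {G : Graph α β} {p : Set β × Set β} {e f : β}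

/-- The pair `(S - e + f, T + e - f)` for `p = (S, T)`. -/
def exchange (e f : β) (p : Set β × Set β) : Set β × Set β :=
  (insert f (p.1 \ {e}), insert e p.2 \ {f})

/-- `IsExchange G p e f`: moving `e` from the first tree of `p` to the second and `f` from the
second to the first gives disjoint spanning trees again. Unlike in `Graph.IsUniqueExchange`, there
may be other choices of `f`. -/
def IsExchange (G : Graph α β) (p : Set β × Set β) (e f : β) : Prop :=
  e ∈ p.1 ∧ f ∈ p.2 ∧ G.IsTreePair (exchange e f p)

theorem isUniqueExchange_iff : G.IsUniqueExchange p.1 p.2 e f ↔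
    IsExchange G p e f ∧ ∀ g, IsExchange G p e g → g = f :=
  ⟨fun h => ⟨⟨h.1, h.2.1, h.2.2.1⟩, fun g hg => h.2.2.2 g hg.2.1 hg.2.2⟩,
    fun h => ⟨h.1.1, h.1.2.1, h.1.2.2, fun g hg hpg => h.2 g ⟨h.1.1, hg, hpg⟩⟩⟩

theorem exchangePair_of_mem (he : e ∈ p.1) : exchangePair e f p = exchange e f p :=
  if_pos he

theorem exchangePair_of_notMem (he : e ∉ p.1) : exchangePair e f p = (exchange e f p.swap).swap :=
  if_neg he

theorem exists_isExchange (hp : G.IsTreePair p) (he : e ∈ p.1) : ∃ f, IsExchange G p e f := by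
  have hd := Set.disjoint_left.1 hp.2.2.1
  obtain ⟨f, hf, -, h₁, h₂⟩ := exists_symm_exchange_of_minimal_connects
    (isSpanningTree_iff_minimal_connects.1 hp.1) (isSpanningTree_iff_minimal_connects.1 hp.2.1) he
  have hef : e ≠ f := fun h => hd he (h ▸ hf)
  refine ⟨f, he, hf, isSpanningTree_iff_minimal_connects.2 h₁, ?_, ?_, ?_⟩
  · rw [exchange, ← Set.insert_sdiff_singleton_comm hef]
    exact isSpanningTree_iff_minimal_connects.2 h₂
  · simp only [exchange, Set.disjoint_left]
    grind
  · rw [← hp.2.2.2]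
    simp only [exchange]
    grind

end Exchange

section MultiIso

variable {α β γ δ : Type*} {G : Graph α β} {H : Graph γ δ} {f : α → γ} {g : β → δ} {T : Set β}

/-- `IsMultiIso G H f g`: the maps `f` and `g` restrict to an isomorphism of multigraphs. This is
`Graph.MultiIso` with maps on the ambient types, along which edge sets can be transported. -/
structure IsMultiIso (G : Graph α β) (H : Graph γ δ) (f : α → γ) (g : β → δ) : Prop where
  bijOn_vertexSet : Set.BijOn f V(G) V(H)
  bijOn_edgeSet : Set.BijOn g E(G) E(H)
  isLink : ∀ e a b, G.IsLink e a b → H.IsLink (g e) (f a) (f b)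

/-- The bundled form of `IsMultiIso`. -/
noncomputable def IsMultiIso.toMultiIso (h : IsMultiIso G H f g) : MultiIso G H where
  vertexEquiv := h.bijOn_vertexSet.equiv f
  edgeEquiv := h.bijOn_edgeSet.equiv g
  isLink_iff e x y := by
    refine ⟨h.isLink e x y, fun hl => ?_⟩
    obtain ⟨a, b, hab⟩ := exists_isLink_of_mem_edgeSet e.2
    have hinj := h.bijOn_vertexSet.injOn
    obtain ⟨hx, hy⟩ | ⟨hx, hy⟩ := (h.isLink e a b hab).eq_and_eq_or_eq_and_eq hl
    · rwa [← hinj hab.left_mem x.2 hx, ← hinj hab.right_mem y.2 hy]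
    · rw [← hinj hab.left_mem y.2 hx, ← hinj hab.right_mem x.2 hy]
      exact hab.symm

theorem exists_isMultiIso (φ : MultiIso G H) (c : γ) (d : δ) :
    ∃ f g, IsMultiIso G H f g := by
  classical
  refine ⟨fun v => if h : v ∈ V(G) then φ.vertexEquiv ⟨v, h⟩ else c,
    fun e => if h : e ∈ E(G) then φ.edgeEquiv ⟨e, h⟩ else d, ?_, ?_, fun e a b hl => ?_⟩
  · refine ⟨fun v hv => by simp [hv], fun v hv w hw hvw => ?_, fun v hv => ?_⟩
    · simpa [hv, hw, Subtype.val_inj] using hvw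
    · exact ⟨φ.vertexEquiv.symm ⟨v, hv⟩, by simp⟩
  · refine ⟨fun e he => by simp [he], fun e he e' he' hee => ?_, fun e he => ?_⟩
    · simpa [he, he', Subtype.val_inj] using hee
    · exact ⟨φ.edgeEquiv.symm ⟨e, he⟩, by simp⟩
  · simpa [hl.edge_mem, hl.left_mem, hl.right_mem] using
      (φ.isLink_iff ⟨e, hl.edge_mem⟩ ⟨a, hl.left_mem⟩ ⟨b, hl.right_mem⟩).1 hl

theorem IsMultiIso.connects_image_iff (h : IsMultiIso G H f g) (hT : T ⊆ E(G)) :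
    Connects H (g '' T) ↔ Connects G T := by
  constructor
  · intro hc
    obtain ⟨z, hz⟩ := hc.1
    obtain ⟨w, hw, rfl⟩ := h.bijOn_vertexSet.surjOn hz
    have : Nonempty α := ⟨w⟩
    have hinv {v : α} (hv : v ∈ V(G)) : Function.invFunOn f V(G) (f v) = v :=
      h.bijOn_vertexSet.injOn.leftInvOn_invFunOn hv
    refine hc.map (Function.invFunOn f V(G)) ⟨w, hw⟩
      (fun v hv => ⟨f v, h.bijOn_vertexSet.mapsTo hv, by rw [hinv hv]; exact .refl _ _ _⟩) ?_
    rintro _ ⟨e, he, rfl⟩ a b hab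
    obtain ⟨x, y, hxy⟩ := exists_isLink_of_mem_edgeSet (hT he)
    have hr := reach_of_isLink hxy he
    obtain ⟨rfl, rfl⟩ | ⟨rfl, rfl⟩ := (h.isLink e x y hxy).eq_and_eq_or_eq_and_eq hab
    · rwa [hinv hxy.left_mem, hinv hxy.right_mem]
    · rw [hinv hxy.left_mem, hinv hxy.right_mem]
      exact hr.symm
  · intro hc
    refine hc.map f (h.bijOn_vertexSet.image_eq ▸ hc.1.image f) (fun v hv => ?_) ?_
    · obtain ⟨w, hw, rfl⟩ := h.bijOn_vertexSet.surjOn hv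
      exact ⟨w, hw, .refl _ _ _⟩
    · intro e he a b hab
      exact reach_of_isLink (h.isLink e a b hab) (Set.mem_image_of_mem g he)

theorem IsMultiIso.isSpanningTree_image_iff (h : IsMultiIso G H f g) (hT : T ⊆ E(G)) :
    H.IsSpanningTree (g '' T) ↔ G.IsSpanningTree T := by
  simp only [isSpanningTree_iff_minimal_connects, minimal_connects_iff, Set.forall_mem_image]
  refine and_congr (h.connects_image_iff hT) (forall₂_congr fun e he => not_congr ?_)
  rw [← h.connects_image_iff (Set.sdiff_subset.trans hT),
    (h.bijOn_edgeSet.injOn.mono hT).image_sdiff_subset (Set.singleton_subset_iff.2 he),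
    Set.image_singleton]

theorem IsMultiIso.isTreePair_image_iff (h : IsMultiIso G H f g) {p : Set β × Set β}
    (h₁ : p.1 ⊆ E(G)) (h₂ : p.2 ⊆ E(G)) :
    H.IsTreePair (g '' p.1, g '' p.2) ↔ G.IsTreePair p := by
  have hinj := h.bijOn_edgeSet.injOn
  refine and_congr (h.isSpanningTree_image_iff h₁) (and_congr (h.isSpanningTree_image_iff h₂)
    (and_congr ?_ ?_))
  · rw [Set.disjoint_iff_inter_eq_empty, Set.disjoint_iff_inter_eq_empty,
      ← hinj.image_inter h₁ h₂, Set.image_eq_empty]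
  · rw [← Set.image_union, ← h.bijOn_edgeSet.image_eq]
    exact hinj.image_eq_image_iff (Set.union_subset h₁ h₂) subset_rfl

end MultiIso

section TwoCliqueSum

variable {α₁ α₂ β₁ β₂ : Type*} {G₁ : Graph α₁ β₁} {G₂ : Graph α₂ β₂} {d₁ : β₁} {d₂ : β₂}
  {x₁ y₁ : α₁} {x₂ y₂ : α₂} {U : Set (β₁ ⊕ β₂)} {W₁ : Set β₁} {W₂ : Set β₂}

theorem twoCliqueSum_isLink_inl {e : β₁} {z w : α₁ ⊕ α₂} :
    (twoCliqueSum G₁ G₂ d₁ d₂ x₁ y₁ x₂ y₂).IsLink (.inl e) z w ↔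
      e ≠ d₁ ∧ ∃ a b, G₁.IsLink e a b ∧ .inl a = z ∧ .inl b = w := by
  simp only [twoCliqueSum, deleteEdges_isLink, map_isLink, Relation.Map, disjointUnion]
  constructor
  · rintro ⟨⟨a | a, b | b, hl, rfl, rfl⟩, hn⟩
    · exact ⟨by simpa using hn, a, b, hl, rfl, rfl⟩
    all_goals exact hl.elim
  · rintro ⟨hne, a, b, hl, rfl, rfl⟩
    exact ⟨⟨.inl a, .inl b, hl, rfl, rfl⟩, by simpa using hne⟩

theorem twoCliqueSum_isLink_inr {e : β₂} {z w : α₁ ⊕ α₂} :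
    (twoCliqueSum G₁ G₂ d₁ d₂ x₁ y₁ x₂ y₂).IsLink (.inr e) z w ↔
      e ≠ d₂ ∧ ∃ a b, G₂.IsLink e a b ∧ glue x₁ y₁ x₂ y₂ (.inr a) = z ∧
        glue x₁ y₁ x₂ y₂ (.inr b) = w := by
  simp only [twoCliqueSum, deleteEdges_isLink, map_isLink, Relation.Map, disjointUnion]
  constructor
  · rintro ⟨⟨a | a, b | b, hl, rfl, rfl⟩, hn⟩
    · exact hl.elim
    · exact hl.elim
    · exact hl.elim
    · exact ⟨by simpa using hn, a, b, hl, rfl, rfl⟩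
  · rintro ⟨hne, a, b, hl, rfl, rfl⟩
    exact ⟨⟨.inr a, .inr b, hl, rfl, rfl⟩, by simpa using hne⟩

theorem vertexSet_twoCliqueSum : V(twoCliqueSum G₁ G₂ d₁ d₂ x₁ y₁ x₂ y₂) =
    Sum.inl '' V(G₁) ∪ (fun v => glue x₁ y₁ x₂ y₂ (.inr v)) '' V(G₂) := by
  simp only [twoCliqueSum, vertexSet_deleteEdges, vertexSet_map, disjointUnion, Set.image_union,
    Set.image_image]
  rfl

theorem edgeSet_twoCliqueSum : E(twoCliqueSum G₁ G₂ d₁ d₂ x₁ y₁ x₂ y₂) =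
    Sum.inl '' (E(G₁) \ {d₁}) ∪ Sum.inr '' (E(G₂) \ {d₂}) := by
  ext (e | e) <;> rw [edge_mem_iff_exists_isLink] <;>
    simp only [twoCliqueSum_isLink_inl, twoCliqueSum_isLink_inr, Set.mem_union,
      Sum.inl_injective.mem_set_image, Sum.inr_injective.mem_set_image, Set.mem_image, reduceCtorEq,
      and_false, exists_false, or_false, false_or, Set.mem_sdiff, Set.mem_singleton_iff,
      edge_mem_iff_exists_isLink]
  · exact ⟨fun ⟨_, _, hne, a, b, hl, _⟩ => ⟨⟨a, b, hl⟩, hne⟩,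
      fun ⟨⟨a, b, hl⟩, hne⟩ => ⟨_, _, hne, a, b, hl, rfl, rfl⟩⟩
  · exact ⟨fun ⟨_, _, hne, a, b, hl, _⟩ => ⟨⟨a, b, hl⟩, hne⟩,
      fun ⟨⟨a, b, hl⟩, hne⟩ => ⟨_, _, hne, a, b, hl, rfl, rfl⟩⟩

theorem glue_inr_left : glue x₁ y₁ x₂ y₂ (.inr x₂) = .inl x₁ := if_pos rfl

theorem glue_inr_right (hne : x₂ ≠ y₂) : glue x₁ y₁ x₂ y₂ (.inr y₂) = .inl y₁ := by
  simp only [glue, if_neg hne.symm, if_pos]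

theorem reach_twoCliqueSum_inl (hl₁ : G₁.IsLink d₁ x₁ y₁) (hW : ∀ e ∈ W₁, e ≠ d₁ → .inl e ∈ U)
    (hd : d₁ ∈ W₁ → Reach (twoCliqueSum G₁ G₂ d₁ d₂ x₁ y₁ x₂ y₂) U (.inl x₁) (.inl y₁))
    {a b : α₁} (h : Reach G₁ W₁ a b) :
    Reach (twoCliqueSum G₁ G₂ d₁ d₂ x₁ y₁ x₂ y₂) U (.inl a) (.inl b) := by
  refine h.map Sum.inl fun e he a b hab => ?_
  by_cases hed : e = d₁
  · subst hed
    obtain ⟨rfl, rfl⟩ | ⟨rfl, rfl⟩ := hl₁.eq_and_eq_or_eq_and_eq hab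
    exacts [hd he, (hd he).symm]
  · exact reach_of_isLink (twoCliqueSum_isLink_inl.2 ⟨hed, a, b, hab, rfl, rfl⟩) (hW e he hed)

theorem reach_twoCliqueSum_inr (hl₂ : G₂.IsLink d₂ x₂ y₂) (hne₂ : x₂ ≠ y₂)
    (hW : ∀ e ∈ W₂, e ≠ d₂ → .inr e ∈ U)
    (hd : d₂ ∈ W₂ → Reach (twoCliqueSum G₁ G₂ d₁ d₂ x₁ y₁ x₂ y₂) U (.inl x₁) (.inl y₁))
    {a b : α₂} (h : Reach G₂ W₂ a b) : Reach (twoCliqueSum G₁ G₂ d₁ d₂ x₁ y₁ x₂ y₂) U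
      (glue x₁ y₁ x₂ y₂ (.inr a)) (glue x₁ y₁ x₂ y₂ (.inr b)) := by
  refine h.map (fun v => glue x₁ y₁ x₂ y₂ (.inr v)) fun e he a b hab => ?_
  by_cases hed : e = d₂
  · subst hed
    obtain ⟨rfl, rfl⟩ | ⟨rfl, rfl⟩ := hl₂.eq_and_eq_or_eq_and_eq hab <;>
      simp only [glue_inr_left, glue_inr_right hne₂]
    exacts [hd he, (hd he).symm]
  · exact reach_of_isLink (twoCliqueSum_isLink_inr.2 ⟨hed, a, b, hab, rfl, rfl⟩) (hW e he hed)

theorem connects_twoCliqueSum (hl₁ : G₁.IsLink d₁ x₁ y₁) (hl₂ : G₂.IsLink d₂ x₂ y₂)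
    (hne₂ : x₂ ≠ y₂) (hW₁ : ∀ e ∈ W₁, e ≠ d₁ → .inl e ∈ U) (hW₂ : ∀ e ∈ W₂, e ≠ d₂ → .inr e ∈ U)
    (h₁ : Connects G₁ W₁) (h₂ : Connects G₂ W₂) (hd : d₁ ∉ W₁ ∨ d₂ ∉ W₂) :
    Connects (twoCliqueSum G₁ G₂ d₁ d₂ x₁ y₁ x₂ y₂) U := by
  have hxy : Reach (twoCliqueSum G₁ G₂ d₁ d₂ x₁ y₁ x₂ y₂) U (.inl x₁) (.inl y₁) := by
    rcases hd with hd | hd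
    · exact reach_twoCliqueSum_inl hl₁ hW₁ (fun h => absurd h hd)
        (h₁.2 _ hl₁.left_mem _ hl₁.right_mem)
    · rw [← glue_inr_left (y₁ := y₁) (y₂ := y₂), ← glue_inr_right (x₁ := x₁) (y₁ := y₁) hne₂]
      exact reach_twoCliqueSum_inr hl₂ hne₂ hW₂ (fun h => absurd h hd)
        (h₂.2 _ hl₂.left_mem _ hl₂.right_mem)
  have hx₁ {z : α₁ ⊕ α₂} (hz : z ∈ V(twoCliqueSum G₁ G₂ d₁ d₂ x₁ y₁ x₂ y₂)) :
      Reach (twoCliqueSum G₁ G₂ d₁ d₂ x₁ y₁ x₂ y₂) U (.inl x₁) z := by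
    rw [vertexSet_twoCliqueSum] at hz
    rcases hz with ⟨a, ha, rfl⟩ | ⟨v, hv, rfl⟩
    · exact reach_twoCliqueSum_inl hl₁ hW₁ (fun _ => hxy) (h₁.2 _ hl₁.left_mem a ha)
    · rw [← glue_inr_left (y₁ := y₁) (y₂ := y₂)]
      exact reach_twoCliqueSum_inr hl₂ hne₂ hW₂ (fun _ => hxy) (h₂.2 _ hl₂.left_mem v hv)
  refine ⟨⟨.inl x₁, ?_⟩, fun z hz w hw => (hx₁ hz).symm.trans (hx₁ hw)⟩
  rw [vertexSet_twoCliqueSum]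
  exact .inl ⟨x₁, hl₁.left_mem, rfl⟩

/-- Contract what `U` reaches of the `G₂`-side to `x₁` and the rest to `y₁`. -/
theorem connects_left_of_connects_twoCliqueSum (hl₁ : G₁.IsLink d₁ x₁ y₁)
    (hU : ∀ e, .inl e ∈ U → e ∈ W₁)
    (hd : Reach G₂ (Sum.inr ⁻¹' U) x₂ y₂ → Reach G₁ W₁ x₁ y₁)
    (h : Connects (twoCliqueSum G₁ G₂ d₁ d₂ x₁ y₁ x₂ y₂) U) : Connects G₁ W₁ := by
  classical
  let φ : α₁ ⊕ α₂ → α₁ :=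
    Sum.elim id fun v => if Reach G₂ (Sum.inr ⁻¹' U) v x₂ then x₁ else y₁
  have hglue (v : α₂) : Reach G₁ W₁ (φ (glue x₁ y₁ x₂ y₂ (.inr v))) (φ (.inr v)) := by
    by_cases hx : v = x₂
    · simp only [hx, glue_inr_left, φ, Sum.elim_inl, Sum.elim_inr, id, Reach.refl, if_true]
    by_cases hy : v = y₂
    · simp only [hy, glue_inr_right fun h => hx (hy.trans h.symm), φ, Sum.elim_inl, Sum.elim_inr,
        id]
      split_ifs with hr
      exacts [(hd hr.symm).symm, .refl _ _ _]
    · simp only [glue, if_neg hx, if_neg hy, Reach.refl]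
  refine h.map φ ⟨x₁, hl₁.left_mem⟩ (fun v hv => ⟨.inl v, ?_, .refl _ _ _⟩) ?_
  · rw [vertexSet_twoCliqueSum]
    exact .inl ⟨v, hv, rfl⟩
  rintro (e | e) he z w hl
  · obtain ⟨-, a, b, hab, rfl, rfl⟩ := twoCliqueSum_isLink_inl.1 hl
    exact reach_of_isLink hab (hU e he)
  · obtain ⟨-, a, b, hab, rfl, rfl⟩ := twoCliqueSum_isLink_inr.1 hl
    have hr : Reach G₂ (Sum.inr ⁻¹' U) a b := reach_of_isLink hab he
    have hφ : φ (.inr a) = φ (.inr b) :=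
      if_congr ⟨hr.symm.trans, hr.trans⟩ rfl rfl
    exact (hglue a).trans (hφ ▸ (hglue b).symm)

/-- Contract what `U` reaches of the `G₁`-side to `x₂` and the rest to `y₂`. -/
theorem connects_right_of_connects_twoCliqueSum (hl₂ : G₂.IsLink d₂ x₂ y₂) (hne₂ : x₂ ≠ y₂)
    (hU : ∀ e, .inr e ∈ U → e ∈ W₂)
    (hd : Reach G₁ (Sum.inl ⁻¹' U) x₁ y₁ → Reach G₂ W₂ x₂ y₂)
    (h : Connects (twoCliqueSum G₁ G₂ d₁ d₂ x₁ y₁ x₂ y₂) U) : Connects G₂ W₂ := by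
  classical
  let φ : α₁ ⊕ α₂ → α₂ :=
    Sum.elim (fun a => if Reach G₁ (Sum.inl ⁻¹' U) a x₁ then x₂ else y₂) id
  have hglue (v : α₂) : Reach G₂ W₂ (φ (glue x₁ y₁ x₂ y₂ (.inr v))) v := by
    by_cases hx : v = x₂
    · simp only [hx, glue_inr_left, φ, Sum.elim_inl, Reach.refl, if_true]
    by_cases hy : v = y₂
    · simp only [hy, glue_inr_right hne₂, φ, Sum.elim_inl]
      split_ifs with hr
      exacts [hd hr.symm, .refl _ _ _]
    · simp only [glue, if_neg hx, if_neg hy, φ, Sum.elim_inr, id, Reach.refl]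
  refine h.map φ ⟨x₂, hl₂.left_mem⟩ (fun v hv => ⟨glue x₁ y₁ x₂ y₂ (.inr v), ?_, hglue v⟩) ?_
  · rw [vertexSet_twoCliqueSum]
    exact .inr ⟨v, hv, rfl⟩
  rintro (e | e) he z w hl
  · obtain ⟨-, a, b, hab, rfl, rfl⟩ := twoCliqueSum_isLink_inl.1 hl
    have hr : Reach G₁ (Sum.inl ⁻¹' U) a b := reach_of_isLink hab he
    have hφ : φ (.inl a) = φ (.inl b) :=
      if_congr ⟨hr.symm.trans, hr.trans⟩ rfl rfl
    exact hφ ▸ .refl _ _ _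
  · obtain ⟨-, a, b, hab, rfl, rfl⟩ := twoCliqueSum_isLink_inr.1 hl
    exact (hglue a).trans ((reach_of_isLink hab (hU e he)).trans (hglue b).symm)

end TwoCliqueSum

section SeamSum

variable {α₁ α₂ β₁ β₂ : Type*} {G : Graph α₁ β₁} {G₁ : Graph α₁ β₁} {G₂ : Graph α₂ β₂}
  {d₁ : β₁} {d₂ : β₂} {x₁ y₁ : α₁} {x₂ y₂ : α₂} {U : Set (β₁ ⊕ β₂)} {U₁ : Set β₁} {U₂ : Set β₂}

/-- Exactly one of `U₁` and `U₂` has to be completed by its seam edge to satisfy `P₁` and `P₂`. For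
connected edge sets, and for spanning trees, this describes the `2`-clique sum. -/
def SeamSum (P₁ : Set β₁ → Prop) (P₂ : Set β₂ → Prop) (d₁ : β₁) (d₂ : β₂) (U₁ : Set β₁)
    (U₂ : Set β₂) : Prop :=
  (P₁ U₁ ∧ P₂ (insert d₂ U₂)) ∨ (P₁ (insert d₁ U₁) ∧ P₂ U₂)

theorem seamSum_comm {P₁ : Set β₁ → Prop} {P₂ : Set β₂ → Prop} :
    SeamSum P₁ P₂ d₁ d₂ U₁ U₂ ↔ SeamSum P₂ P₁ d₂ d₁ U₂ U₁ := by
  simp only [SeamSum, and_comm, or_comm]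

theorem connects_twoCliqueSum_iff (hl₁ : G₁.IsLink d₁ x₁ y₁) (hl₂ : G₂.IsLink d₂ x₂ y₂)
    (hne₂ : x₂ ≠ y₂) (hd₁ : .inl d₁ ∉ U) (hd₂ : .inr d₂ ∉ U) :
    Connects (twoCliqueSum G₁ G₂ d₁ d₂ x₁ y₁ x₂ y₂) U ↔
      SeamSum (Connects G₁) (Connects G₂) d₁ d₂ (Sum.inl ⁻¹' U) (Sum.inr ⁻¹' U) := by
  constructor
  · intro h
    have hx₁ : Reach G₁ (insert d₁ (Sum.inl ⁻¹' U)) x₁ y₁ := reach_of_isLink hl₁ (.inl rfl)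
    have hx₂ : Reach G₂ (insert d₂ (Sum.inr ⁻¹' U)) x₂ y₂ := reach_of_isLink hl₂ (.inl rfl)
    by_cases hr : Reach G₁ (Sum.inl ⁻¹' U) x₁ y₁
    · exact .inl ⟨connects_left_of_connects_twoCliqueSum hl₁ (fun _ => id) (fun _ => hr) h,
        connects_right_of_connects_twoCliqueSum hl₂ hne₂ (fun _ => .inr) (fun _ => hx₂) h⟩
    · exact .inr ⟨connects_left_of_connects_twoCliqueSum hl₁ (fun _ => .inr) (fun _ => hx₁) h,
        connects_right_of_connects_twoCliqueSum hl₂ hne₂ (fun _ => id) (absurd · hr) h⟩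
  · rintro (⟨h₁, h₂⟩ | ⟨h₁, h₂⟩)
    · exact connects_twoCliqueSum hl₁ hl₂ hne₂ (fun _ h _ => h) (fun _ h hne => h.resolve_left hne)
        h₁ h₂ (.inl hd₁)
    · exact connects_twoCliqueSum hl₁ hl₂ hne₂ (fun _ h hne => h.resolve_left hne) (fun _ h _ => h)
        h₁ h₂ (.inr hd₂)

theorem Connects.exists_insert_sdiff (h : Connects G U₁) (hl : G.IsLink d₁ x₁ y₁) (hne : x₁ ≠ y₁) :
    ∃ f ∈ U₁, Connects G (insert d₁ (U₁ \ {f})) := by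
  obtain ⟨f, hf, u, v, huv, -, -, hcut⟩ :=
    (h.2 x₁ hl.left_mem y₁ hl.right_mem).exists_isLink_of_not_cut (· = x₁) rfl hne.symm
  exact ⟨f, hf, h.of_sdiff huv (Set.subset_insert _ _)
    (hcut _ (Set.subset_insert _ _) (reach_of_isLink hl (.inl rfl)))⟩

/-- If `U₂` were already connected, then `d₁` could be exchanged into `U₁`. -/
theorem minimal_connects_and_minimal_connects_insert (hl₁ : G₁.IsLink d₁ x₁ y₁) (hne₁ : x₁ ≠ y₁)
    (hd₂ : d₂ ∉ U₂) (h₁ : Connects G₁ U₁) (h₂ : Connects G₂ (insert d₂ U₂))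
    (hU₁ : ∀ e ∈ U₁, ¬ SeamSum (Connects G₁) (Connects G₂) d₁ d₂ (U₁ \ {e}) U₂)
    (hU₂ : ∀ e ∈ U₂, ¬ SeamSum (Connects G₁) (Connects G₂) d₁ d₂ U₁ (U₂ \ {e})) :
    Minimal (Connects G₁) U₁ ∧ Minimal (Connects G₂) (insert d₂ U₂) := by
  refine ⟨minimal_connects_iff.2 ⟨h₁, fun e he hc => hU₁ e he (.inl ⟨hc, h₂⟩)⟩,
    minimal_connects_iff.2 ⟨h₂, ?_⟩⟩
  rintro e (rfl | he) hc
  · rw [Set.insert_sdiff_self_of_notMem hd₂] at hc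
    obtain ⟨f, hf, hcf⟩ := h₁.exists_insert_sdiff hl₁ hne₁
    exact hU₁ f hf (.inr ⟨hcf, hc⟩)
  · rw [← Set.insert_sdiff_singleton_comm (ne_of_mem_of_not_mem he hd₂).symm] at hc
    exact hU₂ e he (.inl ⟨h₁, hc⟩)

theorem not_seamSum_sdiff (hd₂ : d₂ ∉ U₂) (h₁ : Minimal (Connects G₁) U₁)
    (h₂ : Minimal (Connects G₂) (insert d₂ U₂)) :
    (∀ e ∈ U₁, ¬ SeamSum (Connects G₁) (Connects G₂) d₁ d₂ (U₁ \ {e}) U₂) ∧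
      ∀ e ∈ U₂, ¬ SeamSum (Connects G₁) (Connects G₂) d₁ d₂ U₁ (U₂ \ {e}) := by
  rw [minimal_connects_iff] at h₁ h₂
  have hU₂ : ¬ Connects G₂ U₂ := Set.insert_sdiff_self_of_notMem hd₂ ▸ h₂.2 d₂ (.inl rfl)
  refine ⟨fun e he => ?_, fun e he => ?_⟩
  · rintro (⟨h, -⟩ | ⟨-, h⟩)
    exacts [h₁.2 e he h, hU₂ h]
  · rintro (⟨-, h⟩ | ⟨-, h⟩)
    · rw [Set.insert_sdiff_singleton_comm (ne_of_mem_of_not_mem he hd₂).symm] at h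
      exact h₂.2 e (.inr he) h
    · exact hU₂ (h.mono Set.sdiff_subset)

theorem seamSum_minimal_connects_iff (hl₁ : G₁.IsLink d₁ x₁ y₁) (hl₂ : G₂.IsLink d₂ x₂ y₂)
    (hne₁ : x₁ ≠ y₁) (hne₂ : x₂ ≠ y₂) (hd₁ : d₁ ∉ U₁) (hd₂ : d₂ ∉ U₂) :
    SeamSum (Minimal (Connects G₁)) (Minimal (Connects G₂)) d₁ d₂ U₁ U₂ ↔
      SeamSum (Connects G₁) (Connects G₂) d₁ d₂ U₁ U₂ ∧
      (∀ e ∈ U₁, ¬ SeamSum (Connects G₁) (Connects G₂) d₁ d₂ (U₁ \ {e}) U₂) ∧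
      ∀ e ∈ U₂, ¬ SeamSum (Connects G₁) (Connects G₂) d₁ d₂ U₁ (U₂ \ {e}) := by
  constructor
  · rintro (⟨h₁, h₂⟩ | ⟨h₁, h₂⟩)
    · exact ⟨.inl ⟨h₁.prop, h₂.prop⟩, not_seamSum_sdiff hd₂ h₁ h₂⟩
    · refine ⟨.inr ⟨h₁.prop, h₂.prop⟩, ?_⟩
      have h := not_seamSum_sdiff (d₁ := d₂) hd₁ h₂ h₁
      simp only [seamSum_comm (d₁ := d₂)] at h
      exact h.symm
  · rintro ⟨⟨h₁, h₂⟩ | ⟨h₁, h₂⟩, hU₁, hU₂⟩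
    · exact .inl (minimal_connects_and_minimal_connects_insert hl₁ hne₁ hd₂ h₁ h₂ hU₁ hU₂)
    · simp only [seamSum_comm (d₁ := d₁)] at hU₁ hU₂
      exact .inr
        (minimal_connects_and_minimal_connects_insert hl₂ hne₂ hd₁ h₂ h₁ hU₂ hU₁).symm

theorem isSpanningTree_twoCliqueSum_iff (hl₁ : G₁.IsLink d₁ x₁ y₁) (hl₂ : G₂.IsLink d₂ x₂ y₂)
    (hne₁ : x₁ ≠ y₁) (hne₂ : x₂ ≠ y₂) (hd₁ : .inl d₁ ∉ U) (hd₂ : .inr d₂ ∉ U) :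
    (twoCliqueSum G₁ G₂ d₁ d₂ x₁ y₁ x₂ y₂).IsSpanningTree U ↔
      SeamSum G₁.IsSpanningTree G₂.IsSpanningTree d₁ d₂ (Sum.inl ⁻¹' U) (Sum.inr ⁻¹' U) := by
  have hconn {W : Set (β₁ ⊕ β₂)} (hW : W ⊆ U) :=
    connects_twoCliqueSum_iff hl₁ hl₂ hne₂ (fun h => hd₁ (hW h)) (fun h => hd₂ (hW h))
  have hinl (e : β₁) : Sum.inl ⁻¹' {(.inl e : β₁ ⊕ β₂)} = {e} := by ext; simp
  have hinr (e : β₂) : Sum.inr ⁻¹' {(.inr e : β₁ ⊕ β₂)} = {e} := by ext; simp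
  have hinlr (e : β₁) : Sum.inr ⁻¹' {(.inl e : β₁ ⊕ β₂)} = ∅ := by ext; simp
  have hinrl (e : β₂) : Sum.inl ⁻¹' {(.inr e : β₁ ⊕ β₂)} = ∅ := by ext; simp
  simp only [funext fun T => propext (isSpanningTree_iff_minimal_connects (G := G₁) (T := T)),
    funext fun T => propext (isSpanningTree_iff_minimal_connects (G := G₂) (T := T))]
  rw [isSpanningTree_iff_minimal_connects, minimal_connects_iff,
    seamSum_minimal_connects_iff hl₁ hl₂ hne₁ hne₂ hd₁ hd₂, hconn subset_rfl]
  simp only [Sum.forall, hconn Set.sdiff_subset, Set.preimage_sdiff, hinl, hinr, hinlr, hinrl,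
    Set.sdiff_empty, Set.mem_preimage]

end SeamSum

section TwoSum

variable {α β α₁ α₂ β₁ β₂ : Type*} {G : Graph α β} {G₁ : Graph α₁ β₁} {G₂ : Graph α₂ β₂}
  {d₁ : β₁} {d₂ : β₂} {ι₁ : β₁ → β} {ι₂ : β₂ → β} {U : Set β} {U₁ : Set β₁} {U₂ : Set β₂}
  {p : Set β × Set β} {p₁ q₁ : Set β₁ × Set β₁} {p₂ q₂ : Set β₂ × Set β₂}

/-- The part of the disjoint union of `U₁` and `U₂` that avoids the seam edges `d₁` and `d₂`. -/
def glueSet (d₁ : β₁) (d₂ : β₂) (ι₁ : β₁ → β) (ι₂ : β₂ → β) (U₁ : Set β₁) (U₂ : Set β₂) : Set β :=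
  ι₁ '' (U₁ \ {d₁}) ∪ ι₂ '' (U₂ \ {d₂})

/-- `glueSet` applied to the first and to the second components of two pairs of edge sets. -/
def gluePair (d₁ : β₁) (d₂ : β₂) (ι₁ : β₁ → β) (ι₂ : β₂ → β) (p₁ : Set β₁ × Set β₁)
    (p₂ : Set β₂ × Set β₂) : Set β × Set β :=
  (glueSet d₁ d₂ ι₁ ι₂ p₁.1 p₂.1, glueSet d₁ d₂ ι₁ ι₂ p₁.2 p₂.2)

theorem glueSet_comm : glueSet d₁ d₂ ι₁ ι₂ U₁ U₂ = glueSet d₂ d₁ ι₂ ι₁ U₂ U₁ :=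
  Set.union_comm _ _

theorem gluePair_comm : gluePair d₁ d₂ ι₁ ι₂ p₁ p₂ = gluePair d₂ d₁ ι₂ ι₁ p₂ p₁ :=
  Prod.ext glueSet_comm glueSet_comm

/-- `G` is a `2`-clique sum of `G₁` and `G₂` as far as edges and spanning trees are concerned, where
`ι₁` and `ι₂` embed the edges of the summands. Unlike `Graph.twoCliqueSum`, this notion is literally
symmetric in the summands. -/
structure IsTwoSum (G : Graph α β) (G₁ : Graph α₁ β₁) (G₂ : Graph α₂ β₂) (d₁ : β₁) (d₂ : β₂)
    (ι₁ : β₁ → β) (ι₂ : β₂ → β) : Prop where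
  mem_left : d₁ ∈ E(G₁)
  mem_right : d₂ ∈ E(G₂)
  injective_left : Function.Injective ι₁
  injective_right : Function.Injective ι₂
  ne : ∀ a b, ι₁ a ≠ ι₂ b
  edgeSet_eq : E(G) = glueSet d₁ d₂ ι₁ ι₂ E(G₁) E(G₂)
  isSpanningTree_iff : ∀ U ⊆ E(G), G.IsSpanningTree U ↔
    SeamSum G₁.IsSpanningTree G₂.IsSpanningTree d₁ d₂ (ι₁ ⁻¹' U) (ι₂ ⁻¹' U)

theorem IsTwoSum.symm (h : IsTwoSum G G₁ G₂ d₁ d₂ ι₁ ι₂) : IsTwoSum G G₂ G₁ d₂ d₁ ι₂ ι₁ where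
  mem_left := h.mem_right
  mem_right := h.mem_left
  injective_left := h.injective_right
  injective_right := h.injective_left
  ne a b hab := h.ne b a hab.symm
  edgeSet_eq := h.edgeSet_eq.trans (Set.union_comm _ _)
  isSpanningTree_iff U hU := (h.isSpanningTree_iff U hU).trans seamSum_comm

theorem isTwoSum_twoCliqueSum {x₁ y₁ : α₁} {x₂ y₂ : α₂} (hl₁ : G₁.IsLink d₁ x₁ y₁)
    (hl₂ : G₂.IsLink d₂ x₂ y₂) (hne₁ : x₁ ≠ y₁) (hne₂ : x₂ ≠ y₂) :
    IsTwoSum (twoCliqueSum G₁ G₂ d₁ d₂ x₁ y₁ x₂ y₂) G₁ G₂ d₁ d₂ Sum.inl Sum.inr where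
  mem_left := hl₁.edge_mem
  mem_right := hl₂.edge_mem
  injective_left := Sum.inl_injective
  injective_right := Sum.inr_injective
  ne _ _ := Sum.inl_ne_inr
  edgeSet_eq := edgeSet_twoCliqueSum
  isSpanningTree_iff U hU := by
    rw [edgeSet_twoCliqueSum] at hU
    exact isSpanningTree_twoCliqueSum_iff hl₁ hl₂ hne₁ hne₂ (fun h => by simpa using hU h)
      (fun h => by simpa using hU h)

theorem IsTwoSum.mem_glueSet_left (h : IsTwoSum G G₁ G₂ d₁ d₂ ι₁ ι₂) {a : β₁} :
    ι₁ a ∈ glueSet d₁ d₂ ι₁ ι₂ U₁ U₂ ↔ a ∈ U₁ ∧ a ≠ d₁ := by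
  have hr : ι₁ a ∉ ι₂ '' (U₂ \ {d₂}) := fun ⟨b, _, hb⟩ => h.ne a b hb.symm
  rw [glueSet, Set.mem_union, h.injective_left.mem_set_image, or_iff_left hr, Set.mem_sdiff,
    Set.mem_singleton_iff]

theorem IsTwoSum.mem_glueSet_right (h : IsTwoSum G G₁ G₂ d₁ d₂ ι₁ ι₂) {b : β₂} :
    ι₂ b ∈ glueSet d₁ d₂ ι₁ ι₂ U₁ U₂ ↔ b ∈ U₂ ∧ b ≠ d₂ := by
  rw [glueSet_comm, h.symm.mem_glueSet_left]

theorem IsTwoSum.preimage_glueSet_left (h : IsTwoSum G G₁ G₂ d₁ d₂ ι₁ ι₂) :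
    ι₁ ⁻¹' glueSet d₁ d₂ ι₁ ι₂ U₁ U₂ = U₁ \ {d₁} :=
  Set.ext fun _ => h.mem_glueSet_left

theorem IsTwoSum.preimage_glueSet_right (h : IsTwoSum G G₁ G₂ d₁ d₂ ι₁ ι₂) :
    ι₂ ⁻¹' glueSet d₁ d₂ ι₁ ι₂ U₁ U₂ = U₂ \ {d₂} :=
  Set.ext fun _ => h.mem_glueSet_right

theorem IsTwoSum.glueSet_preimage (h : IsTwoSum G G₁ G₂ d₁ d₂ ι₁ ι₂) (hU : U ⊆ E(G))
    (h₁ : ι₁ ⁻¹' U = U₁ \ {d₁}) (h₂ : ι₂ ⁻¹' U = U₂ \ {d₂}) :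
    glueSet d₁ d₂ ι₁ ι₂ U₁ U₂ = U := by
  rw [glueSet, ← h₁, ← h₂, Set.image_preimage_eq_inter_range, Set.image_preimage_eq_inter_range,
    ← Set.inter_union_distrib_left, Set.inter_eq_left]
  refine hU.trans (h.edgeSet_eq.trans_subset ?_)
  exact Set.union_subset_union (Set.image_subset_range _ _) (Set.image_subset_range _ _)

theorem IsTwoSum.glueSet_subset (h : IsTwoSum G G₁ G₂ d₁ d₂ ι₁ ι₂) (h₁ : U₁ ⊆ E(G₁))
    (h₂ : U₂ ⊆ E(G₂)) : glueSet d₁ d₂ ι₁ ι₂ U₁ U₂ ⊆ E(G) := by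
  rw [h.edgeSet_eq]
  exact Set.union_subset_union (Set.image_mono (Set.sdiff_subset_sdiff_left h₁))
    (Set.image_mono (Set.sdiff_subset_sdiff_left h₂))

theorem IsTwoSum.isSpanningTree_glueSet (h : IsTwoSum G G₁ G₂ d₁ d₂ ι₁ ι₂)
    (h₁ : G₁.IsSpanningTree U₁) (h₂ : G₂.IsSpanningTree U₂) (hd : d₁ ∈ U₁ ↔ d₂ ∉ U₂) :
    G.IsSpanningTree (glueSet d₁ d₂ ι₁ ι₂ U₁ U₂) := by
  rw [h.isSpanningTree_iff _ (h.glueSet_subset h₁.1 h₂.1), h.preimage_glueSet_left,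
    h.preimage_glueSet_right]
  by_cases hd₁ : d₁ ∈ U₁
  · refine .inr ⟨?_, ?_⟩
    · rwa [Set.insert_sdiff_self_of_mem hd₁]
    · rwa [Set.sdiff_singleton_eq_self (hd.1 hd₁)]
  · refine .inl ⟨?_, ?_⟩
    · rwa [Set.sdiff_singleton_eq_self hd₁]
    · rwa [Set.insert_sdiff_self_of_mem (not_not.1 (hd.not.1 hd₁))]

theorem seamSplit_comm : SeamSplit d₁ d₂ p₁ p₂ ↔ SeamSplit d₂ d₁ p₂ p₁ := by
  simp only [SeamSplit, and_comm]

theorem mem_fst_iff_mem_snd_of_seamSplit (hd₁ : d₁ ∈ E(G₁)) (hd₂ : d₂ ∈ E(G₂))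
    (hp₁ : G₁.IsTreePair p₁) (hp₂ : G₂.IsTreePair p₂) (hs : SeamSplit d₁ d₂ p₁ p₂) :
    (d₁ ∈ p₁.1 ↔ d₂ ∈ p₂.2) ∧ (d₁ ∈ p₁.2 ↔ d₂ ∈ p₂.1) := by
  have hdis₁ : d₁ ∈ p₁.1 → d₁ ∉ p₁.2 := fun h => Set.disjoint_left.1 hp₁.2.2.1 h
  have hdis₂ : d₂ ∈ p₂.1 → d₂ ∉ p₂.2 := fun h => Set.disjoint_left.1 hp₂.2.2.1 h
  rw [← hp₁.2.2.2] at hd₁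
  rw [← hp₂.2.2.2] at hd₂
  grind [SeamSplit]

theorem IsTwoSum.isTreePair_gluePair (h : IsTwoSum G G₁ G₂ d₁ d₂ ι₁ ι₂)
    (hp₁ : G₁.IsTreePair p₁) (hp₂ : G₂.IsTreePair p₂) (hs : SeamSplit d₁ d₂ p₁ p₂) :
    G.IsTreePair (gluePair d₁ d₂ ι₁ ι₂ p₁ p₂) := by
  have hd := mem_fst_iff_mem_snd_of_seamSplit h.mem_left h.mem_right hp₁ hp₂ hs
  have hdis : d₂ ∈ p₂.1 → d₂ ∉ p₂.2 := fun h => Set.disjoint_left.1 hp₂.2.2.1 h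
  have hmem := h.mem_right
  rw [← hp₂.2.2.2] at hmem
  have hne := h.ne
  have hinj₁ := h.injective_left
  have hinj₂ := h.injective_right
  refine ⟨h.isSpanningTree_glueSet hp₁.1 hp₂.1 (by grind),
    h.isSpanningTree_glueSet hp₁.2.1 hp₂.2.1 (by grind), ?_, ?_⟩
  · refine Set.disjoint_union_left.2 ⟨?_, ?_⟩ <;> refine Set.disjoint_union_right.2 ⟨?_, ?_⟩
    · exact (Set.disjoint_image_iff hinj₁).2 (hp₁.2.2.1.mono Set.sdiff_subset Set.sdiff_subset)
    · exact Set.disjoint_image_image fun a _ b _ => hne a b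
    · exact Set.disjoint_image_image fun a _ b _ => (hne b a).symm
    · exact (Set.disjoint_image_iff hinj₂).2 (hp₂.2.2.1.mono Set.sdiff_subset Set.sdiff_subset)
  · rw [h.edgeSet_eq, ← hp₁.2.2.2, ← hp₂.2.2.2]
    simp only [gluePair, glueSet, Set.union_sdiff_distrib, Set.image_union]
    exact Set.union_union_union_comm _ _ _ _

theorem isTreePair_insert_right {S T : Set β} {d : β} (hS : G.IsSpanningTree S)
    (hT : G.IsSpanningTree (insert d T)) (hST : Disjoint S T) (hE : S ∪ T = E(G) \ {d}) :
    G.IsTreePair (S, insert d T) := by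
  have hd : d ∈ E(G) := hT.1 (.inl rfl)
  have hdS : d ∉ S := fun h => (hE.le (.inl h)).2 rfl
  exact ⟨hS, hT, Set.disjoint_insert_right.2 ⟨hdS, hST⟩, by
    rw [Set.union_insert, hE, Set.insert_sdiff_self_of_mem hd]⟩

theorem isBispanning_deleteEdges_of_isSpanningTree {S T : Set β} {d : β} (hS : G.IsSpanningTree S)
    (hT : G.IsSpanningTree T) (hST : Disjoint S T) (hE : S ∪ T = E(G) \ {d}) :
    (G.deleteEdges {d}).IsBispanning :=
  ⟨(S, T), isSpanningTree_deleteEdges_singleton_iff.2 ⟨hS, fun h => (hE.le (.inl h)).2 rfl⟩,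
    isSpanningTree_deleteEdges_singleton_iff.2 ⟨hT, fun h => (hE.le (.inr h)).2 rfl⟩, hST, hE⟩

theorem IsTwoSum.preimage_union_preimage_left (h : IsTwoSum G G₁ G₂ d₁ d₂ ι₁ ι₂)
    (hp : G.IsTreePair p) : ι₁ ⁻¹' p.1 ∪ ι₁ ⁻¹' p.2 = E(G₁) \ {d₁} := by
  rw [← Set.preimage_union, hp.2.2.2, h.edgeSet_eq, h.preimage_glueSet_left]

theorem IsTwoSum.exists_gluePair_of_isSpanningTree (h : IsTwoSum G G₁ G₂ d₁ d₂ ι₁ ι₂)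
    (hp : G.IsTreePair p)
    (hS : G₁.IsSpanningTree (ι₁ ⁻¹' p.1) ∧ G₂.IsSpanningTree (insert d₂ (ι₂ ⁻¹' p.1)))
    (hT : G₁.IsSpanningTree (insert d₁ (ι₁ ⁻¹' p.2)) ∧ G₂.IsSpanningTree (ι₂ ⁻¹' p.2)) :
    ∃ p₁ p₂, G₁.IsTreePair p₁ ∧ G₂.IsTreePair p₂ ∧ SeamSplit d₁ d₂ p₁ p₂ ∧
      gluePair d₁ d₂ ι₁ ι₂ p₁ p₂ = p := by
  have hE₁ := h.preimage_union_preimage_left hp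
  have hE₂ := h.symm.preimage_union_preimage_left hp.swap
  have hp₁ := isTreePair_insert_right hS.1 hT.1 (hp.2.2.1.preimage ι₁) hE₁
  have hp₂ := isTreePair_insert_right hT.2 hS.2 (hp.2.2.1.symm.preimage ι₂) hE₂
  have hd₁ : d₁ ∉ ι₁ ⁻¹' p.1 ∪ ι₁ ⁻¹' p.2 := fun hd => (hE₁.le hd).2 rfl
  have hd₂ : d₂ ∉ ι₂ ⁻¹' p.2 ∪ ι₂ ⁻¹' p.1 := fun hd => (hE₂.le hd).2 rfl
  rw [Set.mem_union, not_or] at hd₁ hd₂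
  refine ⟨_, _, hp₁, hp₂.swap, ?_, Prod.ext (h.glueSet_preimage hp.1.1 ?_ ?_)
    (h.glueSet_preimage hp.2.1.1 ?_ ?_)⟩
  · rintro (⟨hd, -⟩ | ⟨-, hd⟩)
    exacts [hd₁.1 hd, hd₂.1 hd]
  · exact (Set.sdiff_singleton_eq_self hd₁.1).symm
  · exact (Set.insert_sdiff_self_of_notMem hd₂.2).symm
  · exact (Set.insert_sdiff_self_of_notMem hd₁.2).symm
  · exact (Set.sdiff_singleton_eq_self hd₂.1).symm

/-- If both trees of `p` induce a spanning tree of the same summand `Gᵢ`, then these two trees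
partition the edges of `Gᵢ` other than `dᵢ`. -/
theorem IsTwoSum.exists_gluePair_or_isBispanning (h : IsTwoSum G G₁ G₂ d₁ d₂ ι₁ ι₂)
    (hp : G.IsTreePair p) : (∃ p₁ p₂, G₁.IsTreePair p₁ ∧ G₂.IsTreePair p₂ ∧
      SeamSplit d₁ d₂ p₁ p₂ ∧ gluePair d₁ d₂ ι₁ ι₂ p₁ p₂ = p) ∨
    (G₁.deleteEdges {d₁}).IsBispanning ∨ (G₂.deleteEdges {d₂}).IsBispanning := by
  rcases (h.isSpanningTree_iff _ hp.1.1).1 hp.1 with hS | hS <;>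
    rcases (h.isSpanningTree_iff _ hp.2.1.1).1 hp.2.1 with hT | hT
  · exact .inr (.inl (isBispanning_deleteEdges_of_isSpanningTree hS.1 hT.1
      (hp.2.2.1.preimage ι₁) (h.preimage_union_preimage_left hp)))
  · exact .inl (h.exists_gluePair_of_isSpanningTree hp hS hT)
  · obtain ⟨p₂, p₁, hp₂, hp₁, hs, rfl⟩ :=
      h.symm.exists_gluePair_of_isSpanningTree hp hS.symm hT.symm
    exact .inl ⟨p₁, p₂, hp₁, hp₂, seamSplit_comm.1 hs, gluePair_comm⟩
  · exact .inr (.inr (isBispanning_deleteEdges_of_isSpanningTree hS.2 hT.2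
      (hp.2.2.1.preimage ι₂) (h.symm.preimage_union_preimage_left hp)))

theorem eq_or_mem_of_sdiff_singleton_subset {S T : Set β} {d : β} (hS : G.IsSpanningTree S)
    (hT : G.IsSpanningTree T) (h : S \ {d} ⊆ T \ {d}) : S = T ∨ d ∈ S ∧ d ∉ T := by
  refine or_iff_not_imp_right.2 fun hd => (exchangeProperty_isSpanningTree G).antichain hS hT ?_
  intro a ha
  by_cases had : a = d
  · grind
  · exact (h ⟨ha, had⟩).1

theorem eq_of_sdiff_singleton_eq {S T : Set β} {d : β} (hS : G.IsSpanningTree S)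
    (hT : G.IsSpanningTree T) (h : S \ {d} = T \ {d}) : S = T := by
  obtain heq | ⟨-, hdT⟩ := eq_or_mem_of_sdiff_singleton_subset hS hT h.le
  · exact heq
  · exact ((eq_or_mem_of_sdiff_singleton_subset hT hS h.ge).resolve_right
      fun hd => hdT hd.1).symm

theorem IsTwoSum.eq_of_gluePair_eq (h : IsTwoSum G G₁ G₂ d₁ d₂ ι₁ ι₂)
    (hp₁ : G₁.IsTreePair p₁) (hq₁ : G₁.IsTreePair q₁)
    (hpq : gluePair d₁ d₂ ι₁ ι₂ p₁ p₂ = gluePair d₁ d₂ ι₁ ι₂ q₁ q₂) : p₁ = q₁ := by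
  have hfst := congrArg (ι₁ ⁻¹' ·.1) hpq
  have hsnd := congrArg (ι₁ ⁻¹' ·.2) hpq
  simp only [gluePair, h.preimage_glueSet_left] at hfst hsnd
  exact Prod.ext (eq_of_sdiff_singleton_eq hp₁.1 hq₁.1 hfst)
    (eq_of_sdiff_singleton_eq hp₁.2.1 hq₁.2.1 hsnd)

end TwoSum

section Exchange

variable {α β α₁ α₂ β₁ β₂ : Type*} {G : Graph α β} {G₁ : Graph α₁ β₁} {G₂ : Graph α₂ β₂}
  {d₁ : β₁} {d₂ : β₂} {ι₁ : β₁ → β} {ι₂ : β₂ → β} {U₁ : Set β₁} {U₂ : Set β₂} {a a' : β₁} {b : β₂}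
  {p₁ q₁ r₁ : Set β₁ × Set β₁} {p₂ q₂ r₂ : Set β₂ × Set β₂}

theorem glueSet_insert_left (ha : a ≠ d₁) :
    glueSet d₁ d₂ ι₁ ι₂ (insert a U₁) U₂ = insert (ι₁ a) (glueSet d₁ d₂ ι₁ ι₂ U₁ U₂) := by
  rw [glueSet, ← Set.insert_sdiff_singleton_comm ha, Set.image_insert_eq, Set.insert_union, glueSet]

theorem glueSet_insert_seam_left :
    glueSet d₁ d₂ ι₁ ι₂ (insert d₁ U₁) U₂ = glueSet d₁ d₂ ι₁ ι₂ U₁ U₂ := by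
  rw [glueSet, Set.insert_sdiff_of_mem _ (Set.mem_singleton d₁), glueSet]

theorem glueSet_sdiff_seam_left :
    glueSet d₁ d₂ ι₁ ι₂ (U₁ \ {d₁}) U₂ = glueSet d₁ d₂ ι₁ ι₂ U₁ U₂ := by
  rw [glueSet, sdiff_idem, glueSet]

theorem IsTwoSum.glueSet_sdiff_left (h : IsTwoSum G G₁ G₂ d₁ d₂ ι₁ ι₂) :
    glueSet d₁ d₂ ι₁ ι₂ (U₁ \ {a}) U₂ = glueSet d₁ d₂ ι₁ ι₂ U₁ U₂ \ {ι₁ a} := by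
  have ha : ι₁ a ∉ ι₂ '' (U₂ \ {d₂}) := fun ⟨b, _, hb⟩ => h.ne a b hb.symm
  rw [glueSet, sdiff_right_comm, Set.image_sdiff h.injective_left, Set.image_singleton, glueSet,
    Set.union_sdiff_distrib, Set.sdiff_singleton_eq_self ha]

theorem IsTwoSum.exchange_gluePair_left (h : IsTwoSum G G₁ G₂ d₁ d₂ ι₁ ι₂) (ha : a ≠ d₁)
    (ha' : a' ≠ d₁) : exchange (ι₁ a) (ι₁ a') (gluePair d₁ d₂ ι₁ ι₂ p₁ p₂) =
      gluePair d₁ d₂ ι₁ ι₂ (exchange a a' p₁) p₂ := by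
  simp only [exchange, gluePair, glueSet_insert_left ha, glueSet_insert_left ha',
    h.glueSet_sdiff_left]

theorem IsTwoSum.exchange_gluePair_across (h : IsTwoSum G G₁ G₂ d₁ d₂ ι₁ ι₂) (ha : a ≠ d₁)
    (hb : b ≠ d₂) : exchange (ι₁ a) (ι₂ b) (gluePair d₁ d₂ ι₁ ι₂ p₁ p₂) =
      gluePair d₁ d₂ ι₁ ι₂ (exchange a d₁ p₁) (exchange d₂ b p₂) := by
  simp only [exchange, gluePair, glueSet_insert_seam_left, glueSet_sdiff_seam_left,
    glueSet_insert_left ha]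
  simp only [h.glueSet_sdiff_left, glueSet_comm (d₁ := d₁)]
  simp only [glueSet_sdiff_seam_left, glueSet_insert_left hb]
  simp only [h.symm.glueSet_sdiff_left, glueSet_insert_seam_left,
    Set.insert_sdiff_singleton_comm (h.ne a b), Set.insert_sdiff_singleton_comm (h.ne a b).symm]

theorem IsTwoSum.eq_of_gluePair_eq_of_mem_iff (h : IsTwoSum G G₁ G₂ d₁ d₂ ι₁ ι₂)
    (hqr : gluePair d₁ d₂ ι₁ ι₂ q₁ q₂ = gluePair d₁ d₂ ι₁ ι₂ r₁ r₂)
    (hfst : d₁ ∈ q₁.1 ↔ d₁ ∈ r₁.1) (hsnd : d₁ ∈ q₁.2 ↔ d₁ ∈ r₁.2) : q₁ = r₁ := by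
  have eq_of_sdiff_eq {S T : Set β₁} (hST : S \ {d₁} = T \ {d₁}) (hd : d₁ ∈ S ↔ d₁ ∈ T) :
      S = T := by
    ext c
    rcases eq_or_ne c d₁ with rfl | hc
    · exact hd
    · simpa [hc] using Set.ext_iff.1 hST c
  have hfst' := congrArg (ι₁ ⁻¹' ·.1) hqr
  have hsnd' := congrArg (ι₁ ⁻¹' ·.2) hqr
  simp only [gluePair, h.preimage_glueSet_left] at hfst' hsnd'
  exact Prod.ext (eq_of_sdiff_eq hfst' hfst) (eq_of_sdiff_eq hsnd' hsnd)

theorem IsTwoSum.eq_of_gluePair_eq_right (h : IsTwoSum G G₁ G₂ d₁ d₂ ι₁ ι₂)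
    (hp₂ : G₂.IsTreePair p₂) (hq₂ : G₂.IsTreePair q₂)
    (hpq : gluePair d₁ d₂ ι₁ ι₂ p₁ p₂ = gluePair d₁ d₂ ι₁ ι₂ q₁ q₂) : p₂ = q₂ :=
  h.symm.eq_of_gluePair_eq hp₂ hq₂ (gluePair_comm.symm.trans (hpq.trans gluePair_comm))

theorem IsTwoSum.exists_gluePair (h : IsTwoSum G G₁ G₂ d₁ d₂ ι₁ ι₂)
    (hd₁ : ¬ (G₁.deleteEdges {d₁}).IsBispanning) (hd₂ : ¬ (G₂.deleteEdges {d₂}).IsBispanning)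
    {p : Set β × Set β} (hp : G.IsTreePair p) :
    ∃ p₁ p₂, G₁.IsTreePair p₁ ∧ G₂.IsTreePair p₂ ∧ SeamSplit d₁ d₂ p₁ p₂ ∧
      gluePair d₁ d₂ ι₁ ι₂ p₁ p₂ = p :=
  (h.exists_gluePair_or_isBispanning hp).resolve_right (not_or.2 ⟨hd₁, hd₂⟩)

theorem IsTwoSum.isExchange_left_iff (h : IsTwoSum G G₁ G₂ d₁ d₂ ι₁ ι₂)
    (hd₁ : ¬ (G₁.deleteEdges {d₁}).IsBispanning) (hd₂ : ¬ (G₂.deleteEdges {d₂}).IsBispanning)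
    (hp₁ : G₁.IsTreePair p₁) (hp₂ : G₂.IsTreePair p₂) (hs : SeamSplit d₁ d₂ p₁ p₂) :
    IsExchange G (gluePair d₁ d₂ ι₁ ι₂ p₁ p₂) (ι₁ a) (ι₁ a') ↔
      IsExchange G₁ p₁ a a' ∧ a ≠ d₁ ∧ a' ≠ d₁ := by
  constructor
  · rintro ⟨ha, ha', hx⟩
    rw [gluePair, h.mem_glueSet_left] at ha ha'
    rw [h.exchange_gluePair_left ha.2 ha'.2] at hx
    obtain ⟨q₁, q₂, hq₁, hq₂, hsq, heq⟩ := h.exists_gluePair hd₁ hd₂ hx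
    obtain rfl := h.eq_of_gluePair_eq_right hq₂ hp₂ heq
    have hseam := mem_fst_iff_mem_snd_of_seamSplit h.mem_left h.mem_right hp₁ hp₂ hs
    have hseam' := mem_fst_iff_mem_snd_of_seamSplit h.mem_left h.mem_right hq₁ hq₂ hsq
    obtain rfl := h.eq_of_gluePair_eq_of_mem_iff heq (by grind [exchange]) (by grind [exchange])
    exact ⟨⟨ha.1, ha'.1, hq₁⟩, ha.2, ha'.2⟩
  · rintro ⟨⟨ha, ha', hx⟩, had, had'⟩
    refine ⟨h.mem_glueSet_left.2 ⟨ha, had⟩, h.mem_glueSet_left.2 ⟨ha', had'⟩, ?_⟩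
    rw [h.exchange_gluePair_left had had']
    exact h.isTreePair_gluePair hx hp₂ (by grind [SeamSplit, exchange])

/-- The second tree gains `a` but not the seam edge, and spanning trees form an antichain: so the
exchange must take the seam edge of `G₁` from the second tree to the first. -/
theorem IsTwoSum.mem_seam_of_gluePair_exchange_eq (h : IsTwoSum G G₁ G₂ d₁ d₂ ι₁ ι₂)
    (hp₁ : G₁.IsTreePair p₁) (hq₁ : G₁.IsTreePair q₁) (ha : a ∈ p₁.1) (had : a ≠ d₁)
    (heq : gluePair d₁ d₂ ι₁ ι₂ q₁ q₂ = gluePair d₁ d₂ ι₁ ι₂ (exchange a d₁ p₁) r₂) :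
    d₁ ∈ p₁.2 ∧ q₁ = exchange a d₁ p₁ := by
  have hdis (c : β₁) : c ∈ p₁.1 → c ∉ p₁.2 := fun hc => Set.disjoint_left.1 hp₁.2.2.1 hc
  have hsnd := congrArg (ι₁ ⁻¹' ·.2) heq
  simp only [gluePair, h.preimage_glueSet_left, exchange, sdiff_idem] at hsnd
  obtain heq' | ⟨hdp, hdq⟩ := eq_or_mem_of_sdiff_singleton_subset hp₁.2.1 hq₁.2.1
    (hsnd ▸ Set.sdiff_subset_sdiff_left (Set.subset_insert a p₁.2))
  · have : a ∈ q₁.2 \ {d₁} := hsnd ▸ ⟨.inl rfl, had⟩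
    exact absurd (heq' ▸ this.1) (hdis a ha)
  · have hdq' : d₁ ∈ q₁.1 := (hq₁.2.2.2.ge h.mem_left).resolve_right hdq
    exact ⟨hdp, h.eq_of_gluePair_eq_of_mem_iff heq (by grind [exchange]) (by grind [exchange])⟩

theorem IsTwoSum.isExchange_across_iff (h : IsTwoSum G G₁ G₂ d₁ d₂ ι₁ ι₂)
    (hd₁ : ¬ (G₁.deleteEdges {d₁}).IsBispanning) (hd₂ : ¬ (G₂.deleteEdges {d₂}).IsBispanning)
    (hp₁ : G₁.IsTreePair p₁) (hp₂ : G₂.IsTreePair p₂) (hs : SeamSplit d₁ d₂ p₁ p₂) :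
    IsExchange G (gluePair d₁ d₂ ι₁ ι₂ p₁ p₂) (ι₁ a) (ι₂ b) ↔
      IsExchange G₁ p₁ a d₁ ∧ IsExchange G₂ p₂ d₂ b := by
  have hseam := mem_fst_iff_mem_snd_of_seamSplit h.mem_left h.mem_right hp₁ hp₂ hs
  have hdis₁ := Set.disjoint_left.1 hp₁.2.2.1
  have hdis₂ := Set.disjoint_left.1 hp₂.2.2.1
  constructor
  · rintro ⟨ha, hb, hx⟩
    rw [gluePair, h.mem_glueSet_left] at ha
    rw [gluePair, h.mem_glueSet_right] at hb
    rw [h.exchange_gluePair_across ha.2 hb.2] at hx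
    obtain ⟨q₁, q₂, hq₁, hq₂, hsq, heq⟩ := h.exists_gluePair hd₁ hd₂ hx
    obtain ⟨hd, rfl⟩ := h.mem_seam_of_gluePair_exchange_eq hp₁ hq₁ ha.1 ha.2 heq
    have hd' := hseam.2.1 hd
    have hseam' := mem_fst_iff_mem_snd_of_seamSplit h.mem_left h.mem_right hq₁ hq₂ hsq
    obtain rfl := h.symm.eq_of_gluePair_eq_of_mem_iff
      (gluePair_comm.symm.trans (heq.trans gluePair_comm)) (by grind [exchange])
      (by grind [exchange])
    exact ⟨⟨ha.1, hd, hq₁⟩, hd', hb.1, hq₂⟩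
  · rintro ⟨⟨ha, hd, hx₁⟩, hd', hb, hx₂⟩
    have had : a ≠ d₁ := fun had => hdis₁ ha (had ▸ hd)
    have hbd : b ≠ d₂ := fun hbd => hdis₂ hd' (hbd ▸ hb)
    refine ⟨h.mem_glueSet_left.2 ⟨ha, had⟩, h.mem_glueSet_right.2 ⟨hb, hbd⟩, ?_⟩
    rw [h.exchange_gluePair_across had hbd]
    exact h.isTreePair_gluePair hx₁ hx₂ (by grind [SeamSplit, exchange])

theorem IsTwoSum.exists_of_isExchange (h : IsTwoSum G G₁ G₂ d₁ d₂ ι₁ ι₂)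
    {p : Set β × Set β} {e f : β} (hp : G.IsTreePair p) (hx : IsExchange G p e f) :
    (∃ a, ι₁ a = f) ∨ ∃ b, ι₂ b = f := by
  obtain ⟨a, -, ha⟩ | ⟨b, -, hb⟩ := h.edgeSet_eq.le (hp.2.1.1 hx.2.1)
  exacts [.inl ⟨a, ha⟩, .inr ⟨b, hb⟩]

theorem IsTwoSum.isUniqueExchange_left_iff (h : IsTwoSum G G₁ G₂ d₁ d₂ ι₁ ι₂)
    (hd₁ : ¬ (G₁.deleteEdges {d₁}).IsBispanning) (hd₂ : ¬ (G₂.deleteEdges {d₂}).IsBispanning)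
    (hp₁ : G₁.IsTreePair p₁) (hp₂ : G₂.IsTreePair p₂) (hs : SeamSplit d₁ d₂ p₁ p₂) :
    G.IsUniqueExchange (gluePair d₁ d₂ ι₁ ι₂ p₁ p₂).1 (gluePair d₁ d₂ ι₁ ι₂ p₁ p₂).2
      (ι₁ a) (ι₁ a') ↔ G₁.IsUniqueExchange p₁.1 p₁.2 a a' ∧ ¬ (a = d₁ ∨ a' = d₁) := by
  rw [isUniqueExchange_iff, isUniqueExchange_iff, h.isExchange_left_iff hd₁ hd₂ hp₁ hp₂ hs,
    not_or, and_right_comm (b := ∀ c, _)]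
  refine and_congr_right fun ⟨_, had, had'⟩ => ⟨fun hu c hc => ?_, fun hu g hg => ?_⟩
  · have hcd : c ≠ d₁ := by
      rintro rfl
      have hseam := mem_fst_iff_mem_snd_of_seamSplit h.mem_left h.mem_right hp₁ hp₂ hs
      obtain ⟨b, hb⟩ := exists_isExchange hp₂ (hseam.2.1 hc.2.1)
      exact h.ne a' b (hu _ ((h.isExchange_across_iff hd₁ hd₂ hp₁ hp₂ hs).2 ⟨hc, hb⟩)).symm
    exact h.injective_left
      (hu _ ((h.isExchange_left_iff hd₁ hd₂ hp₁ hp₂ hs).2 ⟨hc, had, hcd⟩))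
  · obtain ⟨c, rfl⟩ | ⟨b, rfl⟩ := h.exists_of_isExchange (h.isTreePair_gluePair hp₁ hp₂ hs) hg
    · rw [hu c ((h.isExchange_left_iff hd₁ hd₂ hp₁ hp₂ hs).1 hg).1]
    · exact absurd (hu d₁ ((h.isExchange_across_iff hd₁ hd₂ hp₁ hp₂ hs).1 hg).1).symm had'

theorem IsTwoSum.isUniqueExchange_across_iff (h : IsTwoSum G G₁ G₂ d₁ d₂ ι₁ ι₂)
    (hd₁ : ¬ (G₁.deleteEdges {d₁}).IsBispanning) (hd₂ : ¬ (G₂.deleteEdges {d₂}).IsBispanning)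
    (hp₁ : G₁.IsTreePair p₁) (hp₂ : G₂.IsTreePair p₂) (hs : SeamSplit d₁ d₂ p₁ p₂) :
    G.IsUniqueExchange (gluePair d₁ d₂ ι₁ ι₂ p₁ p₂).1 (gluePair d₁ d₂ ι₁ ι₂ p₁ p₂).2
      (ι₁ a) (ι₂ b) ↔
      G₁.IsUniqueExchange p₁.1 p₁.2 a d₁ ∧ G₂.IsUniqueExchange p₂.1 p₂.2 d₂ b := by
  rw [isUniqueExchange_iff, isUniqueExchange_iff, isUniqueExchange_iff,
    h.isExchange_across_iff hd₁ hd₂ hp₁ hp₂ hs, and_and_and_comm]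
  refine and_congr_right fun ⟨hx₁, _⟩ => ⟨fun hu => ⟨fun c hc => ?_, fun c hc => ?_⟩, ?_⟩
  · by_contra hcd
    have had : a ≠ d₁ := fun had => Set.disjoint_left.1 hp₁.2.2.1 hx₁.1 (had ▸ hx₁.2.1)
    exact h.ne c b (hu _ ((h.isExchange_left_iff hd₁ hd₂ hp₁ hp₂ hs).2 ⟨hc, had, hcd⟩))
  · exact h.injective_right
      (hu _ ((h.isExchange_across_iff hd₁ hd₂ hp₁ hp₂ hs).2 ⟨hx₁, hc⟩))
  · rintro ⟨hu₁, hu₂⟩ g hg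
    obtain ⟨c, rfl⟩ | ⟨c, rfl⟩ := h.exists_of_isExchange (h.isTreePair_gluePair hp₁ hp₂ hs) hg
    · have hc := (h.isExchange_left_iff hd₁ hd₂ hp₁ hp₂ hs).1 hg
      exact absurd (hu₁ c hc.1) hc.2.2
    · rw [hu₂ c ((h.isExchange_across_iff hd₁ hd₂ hp₁ hp₂ hs).1 hg).2]

/-- The pair of disjoint spanning trees of a `2`-clique sum that a vertex of the join stands for. -/
def IsTwoSum.glueVert (h : IsTwoSum G G₁ G₂ d₁ d₂ ι₁ ι₂) (q : JoinVert G₁ G₂ d₁ d₂) :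
    G.TreePair :=
  ⟨gluePair d₁ d₂ ι₁ ι₂ q.1.1.1 q.1.2.1, h.isTreePair_gluePair q.1.1.2 q.1.2.2 q.2⟩

theorem IsTwoSum.glueVert_swap (h : IsTwoSum G G₁ G₂ d₁ d₂ ι₁ ι₂) (q : JoinVert G₁ G₂ d₁ d₂) :
    h.symm.glueVert ⟨q.1.swap, seamSplit_comm.1 q.2⟩ = h.glueVert q :=
  Subtype.ext gluePair_comm

theorem IsTwoSum.glueVert_bijective (h : IsTwoSum G G₁ G₂ d₁ d₂ ι₁ ι₂)
    (hd₁ : ¬ (G₁.deleteEdges {d₁}).IsBispanning) (hd₂ : ¬ (G₂.deleteEdges {d₂}).IsBispanning) :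
    Function.Bijective h.glueVert := by
  constructor
  · intro q q' hq
    have hpair := congrArg Subtype.val hq
    exact Subtype.ext (Prod.ext (Subtype.ext (h.eq_of_gluePair_eq q.1.1.2 q'.1.1.2 hpair))
      (Subtype.ext (h.eq_of_gluePair_eq_right q.1.2.2 q'.1.2.2 hpair)))
  · rintro ⟨p, hp⟩
    obtain ⟨p₁, p₂, hp₁, hp₂, hs, rfl⟩ := h.exists_gluePair hd₁ hd₂ hp
    exact ⟨⟨(⟨p₁, hp₁⟩, ⟨p₂, hp₂⟩), hs⟩, rfl⟩

theorem seamSplit_swap : SeamSplit d₁ d₂ p₁.swap p₂.swap ↔ SeamSplit d₁ d₂ p₁ p₂ := by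
  simp only [SeamSplit, Prod.fst_swap, Prod.snd_swap, or_comm]

theorem IsTwoSum.isTauThreeArc_left_iff (h : IsTwoSum G G₁ G₂ d₁ d₂ ι₁ ι₂)
    (hd₁ : ¬ (G₁.deleteEdges {d₁}).IsBispanning) (hd₂ : ¬ (G₂.deleteEdges {d₂}).IsBispanning)
    (q : JoinVert G₁ G₂ d₁ d₂) : G.IsTauThreeArc (ι₁ a) (ι₁ a') (h.glueVert q) ↔
      G₁.IsTauThreeArc a a' q.1.1 ∧ ¬ (a = d₁ ∨ a' = d₁) :=
  (or_congr (h.isUniqueExchange_left_iff hd₁ hd₂ q.1.1.2 q.1.2.2 q.2)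
    (h.isUniqueExchange_left_iff hd₁ hd₂ q.1.1.2.swap q.1.2.2.swap (seamSplit_swap.2 q.2))).trans
    or_and_right.symm

theorem IsTwoSum.isTauThreeArc_across_iff (h : IsTwoSum G G₁ G₂ d₁ d₂ ι₁ ι₂)
    (hd₁ : ¬ (G₁.deleteEdges {d₁}).IsBispanning) (hd₂ : ¬ (G₂.deleteEdges {d₂}).IsBispanning)
    (q : JoinVert G₁ G₂ d₁ d₂) : G.IsTauThreeArc (ι₁ a) (ι₂ b) (h.glueVert q) ↔
      G₁.IsTauThreeArc a d₁ q.1.1 ∧ G₂.IsTauThreeArc d₂ b q.1.2 := by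
  refine (or_congr (h.isUniqueExchange_across_iff hd₁ hd₂ q.1.1.2 q.1.2.2 q.2)
    (h.isUniqueExchange_across_iff hd₁ hd₂ q.1.1.2.swap q.1.2.2.swap
      (seamSplit_swap.2 q.2))).trans ⟨?_, ?_⟩
  · rintro (⟨h₁, h₂⟩ | ⟨h₁, h₂⟩)
    exacts [⟨.inl h₁, .inl h₂⟩, ⟨.inr h₁, .inr h₂⟩]
  · rintro ⟨h₁ | h₁, h₂ | h₂⟩
    · exact .inl ⟨h₁, h₂⟩
    · exact absurd (.inr ⟨h₁.2.1, h₂.1⟩) q.2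
    · exact absurd (.inl ⟨h₁.2.1, h₂.1⟩) q.2
    · exact .inr ⟨h₁, h₂⟩

theorem IsTwoSum.isTauThreeArc_iff_isJoinArc (h : IsTwoSum G G₁ G₂ d₁ d₂ ι₁ ι₂)
    (hd₁ : ¬ (G₁.deleteEdges {d₁}).IsBispanning) (hd₂ : ¬ (G₂.deleteEdges {d₂}).IsBispanning)
    (q : JoinVert G₁ G₂ d₁ d₂) (e f : β₁ ⊕ β₂) :
    G.IsTauThreeArc (Sum.elim ι₁ ι₂ e) (Sum.elim ι₁ ι₂ f) (h.glueVert q) ↔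
      IsJoinArc d₁ d₂ q.1 e f := by
  rcases e with e | e <;> rcases f with f | f
  · exact h.isTauThreeArc_left_iff hd₁ hd₂ q
  · exact h.isTauThreeArc_across_iff hd₁ hd₂ q
  · rw [← h.glueVert_swap]
    exact h.symm.isTauThreeArc_across_iff hd₂ hd₁ _
  · rw [← h.glueVert_swap]
    exact h.symm.isTauThreeArc_left_iff hd₂ hd₁ _

theorem IsTwoSum.exchangePair_gluePair_left (h : IsTwoSum G G₁ G₂ d₁ d₂ ι₁ ι₂) (ha : a ≠ d₁)
    (ha' : a' ≠ d₁) : exchangePair (ι₁ a) (ι₁ a') (gluePair d₁ d₂ ι₁ ι₂ p₁ p₂) =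
      gluePair d₁ d₂ ι₁ ι₂ (exchangePair a a' p₁) p₂ := by
  have hmem : ι₁ a ∈ (gluePair d₁ d₂ ι₁ ι₂ p₁ p₂).1 ↔ a ∈ p₁.1 :=
    h.mem_glueSet_left.trans (and_iff_left ha)
  by_cases hap : a ∈ p₁.1
  · rw [exchangePair_of_mem hap, exchangePair_of_mem (hmem.2 hap),
      h.exchange_gluePair_left ha ha']
  · rw [exchangePair_of_notMem hap, exchangePair_of_notMem (mt hmem.1 hap)]
    exact congrArg Prod.swap (h.exchange_gluePair_left (p₁ := p₁.swap) (p₂ := p₂.swap) ha ha')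

theorem IsTwoSum.exchangePair_gluePair_across (h : IsTwoSum G G₁ G₂ d₁ d₂ ι₁ ι₂) (ha : a ≠ d₁)
    (hb : b ≠ d₂) (hab : a ∈ p₁.1 ↔ d₂ ∈ p₂.1) :
    exchangePair (ι₁ a) (ι₂ b) (gluePair d₁ d₂ ι₁ ι₂ p₁ p₂) =
      gluePair d₁ d₂ ι₁ ι₂ (exchangePair a d₁ p₁) (exchangePair d₂ b p₂) := by
  have hmem : ι₁ a ∈ (gluePair d₁ d₂ ι₁ ι₂ p₁ p₂).1 ↔ a ∈ p₁.1 :=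
    h.mem_glueSet_left.trans (and_iff_left ha)
  by_cases hap : a ∈ p₁.1
  · rw [exchangePair_of_mem hap, exchangePair_of_mem (hmem.2 hap), exchangePair_of_mem (hab.1 hap),
      h.exchange_gluePair_across ha hb]
  · rw [exchangePair_of_notMem hap, exchangePair_of_notMem (mt hmem.1 hap),
      exchangePair_of_notMem (mt hab.2 hap)]
    exact congrArg Prod.swap (h.exchange_gluePair_across (p₁ := p₁.swap) (p₂ := p₂.swap) ha hb)

theorem isTauThreeArc_ne {e f : β} {p : G.TreePair} (h : G.IsTauThreeArc e f p) : e ≠ f := by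
  rintro rfl
  rcases h with h | h
  · exact Set.disjoint_left.1 p.2.2.2.1 h.1 h.2.1
  · exact Set.disjoint_left.1 p.2.2.2.1 h.2.1 h.1

theorem mem_fst_iff_mem_snd_of_isTauThreeArc {e f : β} {p : G.TreePair}
    (h : G.IsTauThreeArc e f p) : e ∈ p.1.1 ↔ f ∈ p.1.2 := by
  have hdis := Set.disjoint_left.1 p.2.2.2.1
  rcases h with h | h
  · exact iff_of_true h.1 h.2.1
  · exact iff_of_false (fun he => hdis he h.1) (hdis h.2.1)

theorem IsTwoSum.exchangePair_glueVert_across (h : IsTwoSum G G₁ G₂ d₁ d₂ ι₁ ι₂)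
    (q : JoinVert G₁ G₂ d₁ d₂) (ha : G₁.IsTauThreeArc a d₁ q.1.1)
    (hb : G₂.IsTauThreeArc d₂ b q.1.2) : exchangePair (ι₁ a) (ι₂ b) (h.glueVert q).1 =
      gluePair d₁ d₂ ι₁ ι₂ ha.head.1 hb.head.1 :=
  h.exchangePair_gluePair_across (isTauThreeArc_ne ha) (isTauThreeArc_ne hb).symm
    ((mem_fst_iff_mem_snd_of_isTauThreeArc ha).trans
      (mem_fst_iff_mem_snd_of_seamSplit h.mem_left h.mem_right q.1.1.2 q.1.2.2 q.2).2)

theorem IsTwoSum.exchangePair_glueVert (h : IsTwoSum G G₁ G₂ d₁ d₂ ι₁ ι₂)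
    (q : JoinVert G₁ G₂ d₁ d₂) {e f : β₁ ⊕ β₂} (ha : IsJoinArc d₁ d₂ q.1 e f) :
    exchangePair (Sum.elim ι₁ ι₂ e) (Sum.elim ι₁ ι₂ f) (h.glueVert q).1 =
      (h.glueVert (joinHead q e f ha)).1 := by
  rcases e with e | e <;> rcases f with f | f
  · exact h.exchangePair_gluePair_left (not_or.1 ha.2).1 (not_or.1 ha.2).2
  · exact h.exchangePair_glueVert_across q ha.1 ha.2
  · rw [← h.glueVert_swap, ← h.glueVert_swap]
    exact h.symm.exchangePair_glueVert_across _ ha.1 ha.2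
  · rw [← h.glueVert_swap, ← h.glueVert_swap]
    exact h.symm.exchangePair_gluePair_left (not_or.1 ha.2).1 (not_or.1 ha.2).2

theorem IsTwoSum.nonempty_iso_tauThreeJoin {H : Graph α (β₁ ⊕ β₂)}
    (h : IsTwoSum H G₁ G₂ d₁ d₂ Sum.inl Sum.inr) (hd₁ : ¬ (G₁.deleteEdges {d₁}).IsBispanning)
    (hd₂ : ¬ (G₂.deleteEdges {d₂}).IsBispanning) :
    Nonempty ((tauThreeJoin G₁ G₂ d₁ d₂).Iso H.tauThree) := by
  let vertEquiv := Equiv.ofBijective h.glueVert (h.glueVert_bijective hd₁ hd₂)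
  refine ⟨⟨vertEquiv, ((Equiv.refl _).prodCongr ((Equiv.refl _).prodCongr vertEquiv)).subtypeEquiv
    fun a => ?_, fun a => Prod.ext rfl (Subtype.ext ?_)⟩⟩
  · have harc := h.isTauThreeArc_iff_isJoinArc hd₁ hd₂ a.2.2 a.1 a.2.1
    rw [Sum.elim_inl_inr] at harc
    exact harc.symm
  · have hhead := h.exchangePair_glueVert a.1.2.2 a.2
    rw [Sum.elim_inl_inr] at hhead
    exact hhead

end Exchange

section Transport

variable {α β γ δ : Type*} {G : Graph α β} {H : Graph γ δ} {f : α → γ} {g : β → δ}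
  {p : Set β × Set β} {a b : β}

theorem exchange_image (hg : Set.InjOn g (p.1 ∪ p.2)) (ha : a ∈ p.1) (hb : b ∈ p.2) :
    exchange (g a) (g b) (g '' p.1, g '' p.2) =
      (g '' (exchange a b p).1, g '' (exchange a b p).2) := by
  have hsub : insert a p.2 ⊆ p.1 ∪ p.2 :=
    Set.insert_subset (.inl ha) Set.subset_union_right
  simp only [exchange, Set.image_insert_eq]
  rw [(hg.mono Set.subset_union_left).image_sdiff_subset (Set.singleton_subset_iff.2 ha),
    (hg.mono hsub).image_sdiff_subset (Set.singleton_subset_iff.2 (.inr hb)), Set.image_singleton,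
    Set.image_singleton, Set.image_insert_eq]

theorem IsMultiIso.isExchange_image_iff (h : IsMultiIso G H f g) (hp : G.IsTreePair p)
    (ha : a ∈ E(G)) (hb : b ∈ E(G)) :
    IsExchange H (g '' p.1, g '' p.2) (g a) (g b) ↔ IsExchange G p a b := by
  have hinj := h.bijOn_edgeSet.injOn
  rw [IsExchange, IsExchange, hinj.mem_image_iff hp.1.1 ha, hinj.mem_image_iff hp.2.1.1 hb]
  refine and_congr_right fun hap => and_congr_right fun hbp => ?_
  rw [exchange_image (hinj.mono hp.2.2.2.le) hap hbp]
  exact h.isTreePair_image_iff (Set.insert_subset hb (Set.sdiff_subset.trans hp.1.1))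
    (Set.sdiff_subset.trans (Set.insert_subset ha hp.2.1.1))

theorem IsMultiIso.isUniqueExchange_image_iff (h : IsMultiIso G H f g) (hp : G.IsTreePair p)
    (ha : a ∈ E(G)) (hb : b ∈ E(G)) :
    H.IsUniqueExchange (g '' p.1) (g '' p.2) (g a) (g b) ↔ G.IsUniqueExchange p.1 p.2 a b := by
  refine (isUniqueExchange_iff (p := (g '' p.1, g '' p.2))).trans
    (Iff.trans ?_ isUniqueExchange_iff.symm)
  rw [h.isExchange_image_iff hp ha hb]
  refine and_congr_right fun _ => ⟨fun hu c hc => ?_, fun hu c hc => ?_⟩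
  · have hcE := hp.2.1.1 hc.2.1
    exact h.bijOn_edgeSet.injOn hcE hb (hu _ ((h.isExchange_image_iff hp ha hcE).2 hc))
  · obtain ⟨c, hcp, rfl⟩ := hc.2.1
    rw [hu c ((h.isExchange_image_iff hp ha (hp.2.1.1 hcp)).1 hc)]

/-- The image of a pair of disjoint spanning trees under an isomorphism. -/
def IsMultiIso.mapTreePair (h : IsMultiIso G H f g) (p : G.TreePair) : H.TreePair :=
  ⟨(g '' p.1.1, g '' p.1.2), (h.isTreePair_image_iff p.2.1.1 p.2.2.1.1).2 p.2⟩

theorem IsMultiIso.mapTreePair_bijective (h : IsMultiIso G H f g) :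
    Function.Bijective h.mapTreePair := by
  have hinj := h.bijOn_edgeSet.injOn
  constructor
  · intro p q hpq
    have hval := Prod.ext_iff.1 (congrArg Subtype.val hpq)
    exact Subtype.ext (Prod.ext ((hinj.image_eq_image_iff p.2.1.1 q.2.1.1).1 hval.1)
      ((hinj.image_eq_image_iff p.2.2.1.1 q.2.2.1.1).1 hval.2))
  · rintro ⟨⟨S, T⟩, hq⟩
    obtain ⟨S, hS, rfl⟩ := Set.subset_image_iff.1 (hq.1.1.trans h.bijOn_edgeSet.image_eq.ge)
    obtain ⟨T, hT, rfl⟩ := Set.subset_image_iff.1 (hq.2.1.1.trans h.bijOn_edgeSet.image_eq.ge)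
    exact ⟨⟨(S, T), (h.isTreePair_image_iff hS hT).1 hq⟩, rfl⟩

theorem IsMultiIso.isBispanning_iff (h : IsMultiIso G H f g) : G.IsBispanning ↔ H.IsBispanning :=
  ⟨fun ⟨p, hp⟩ => ⟨_, (h.mapTreePair ⟨p, hp⟩).2⟩,
    fun ⟨q, hq⟩ => let ⟨p, _⟩ := h.mapTreePair_bijective.2 ⟨q, hq⟩; ⟨p.1, p.2⟩⟩

theorem mem_edgeSet_of_isTauThreeArc {p : G.TreePair} (ha : G.IsTauThreeArc a b p) :
    a ∈ E(G) ∧ b ∈ E(G) := by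
  rcases ha with ha | ha
  · exact ⟨p.2.1.1 ha.1, p.2.2.1.1 ha.2.1⟩
  · exact ⟨p.2.2.1.1 ha.1, p.2.1.1 ha.2.1⟩

theorem IsMultiIso.isTauThreeArc_iff (h : IsMultiIso G H f g) {p : G.TreePair} (ha : a ∈ E(G))
    (hb : b ∈ E(G)) : H.IsTauThreeArc (g a) (g b) (h.mapTreePair p) ↔ G.IsTauThreeArc a b p :=
  or_congr (h.isUniqueExchange_image_iff p.2 ha hb) (h.isUniqueExchange_image_iff p.2.swap ha hb)

/-- The image of an arc of the directed unique exchange graph under an isomorphism. -/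
def IsMultiIso.mapArc (h : IsMultiIso G H f g) (a : G.tauThree.Arc) : H.tauThree.Arc :=
  ⟨(g a.1.1, g a.1.2.1, h.mapTreePair a.1.2.2),
    (h.isTauThreeArc_iff (mem_edgeSet_of_isTauThreeArc a.2).1
      (mem_edgeSet_of_isTauThreeArc a.2).2).2 a.2⟩

theorem IsMultiIso.mapArc_bijective (h : IsMultiIso G H f g) : Function.Bijective h.mapArc := by
  have hinj := h.bijOn_edgeSet.injOn
  constructor
  · rintro ⟨⟨a, b, p⟩, harc⟩ ⟨⟨a', b', p'⟩, harc'⟩ heq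
    obtain ⟨ha, hb, hp⟩ := by simpa only [mapArc, Prod.mk.injEq] using congrArg Subtype.val heq
    have hmem := mem_edgeSet_of_isTauThreeArc harc
    have hmem' := mem_edgeSet_of_isTauThreeArc harc'
    obtain rfl := hinj hmem.1 hmem'.1 ha
    obtain rfl := hinj hmem.2 hmem'.2 hb
    obtain rfl := h.mapTreePair_bijective.1 hp
    rfl
  · rintro ⟨⟨e, e', q⟩, harc⟩
    obtain ⟨he, he'⟩ := mem_edgeSet_of_isTauThreeArc harc
    obtain ⟨a, ha, rfl⟩ := h.bijOn_edgeSet.surjOn he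
    obtain ⟨b, hb, rfl⟩ := h.bijOn_edgeSet.surjOn he'
    obtain ⟨p, rfl⟩ := h.mapTreePair_bijective.2 q
    exact ⟨⟨(a, b, p), (h.isTauThreeArc_iff ha hb).1 harc⟩, rfl⟩

theorem IsMultiIso.exchangePair_mapTreePair (h : IsMultiIso G H f g) {p : G.TreePair}
    (ha : G.IsTauThreeArc a b p) :
    exchangePair (g a) (g b) (h.mapTreePair p).1 = (h.mapTreePair ha.head).1 := by
  have hinj := h.bijOn_edgeSet.injOn
  have hmem : g a ∈ (h.mapTreePair p).1.1 ↔ a ∈ p.1.1 :=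
    hinj.mem_image_iff p.2.1.1 (mem_edgeSet_of_isTauThreeArc ha).1
  have hunion : Set.InjOn g (p.1.1 ∪ p.1.2) := hinj.mono p.2.2.2.2.le
  by_cases hap : a ∈ p.1.1
  · have hbp := (mem_fst_iff_mem_snd_of_isTauThreeArc ha).1 hap
    rw [exchangePair_of_mem (hmem.2 hap)]
    refine (exchange_image hunion hap hbp).trans ?_
    rw [← exchangePair_of_mem hap]
    rfl
  · have harc := ha.resolve_left fun hu => hap hu.1
    rw [exchangePair_of_notMem (mt hmem.1 hap)]
    refine (congrArg Prod.swap
      (exchange_image (p := p.1.swap) (Set.union_comm _ _ ▸ hunion) harc.1 harc.2.1)).trans ?_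
    refine Eq.trans ?_ (congrArg (fun q => (g '' q.1, g '' q.2)) (exchangePair_of_notMem hap).symm)
    rfl

theorem IsMultiIso.nonempty_tauThree_iso (h : IsMultiIso G H f g) :
    Nonempty (G.tauThree.Iso H.tauThree) :=
  ⟨⟨Equiv.ofBijective _ h.mapTreePair_bijective, Equiv.ofBijective _ h.mapArc_bijective,
    fun a => Prod.ext rfl (Subtype.ext (h.exchangePair_mapTreePair a.2))⟩⟩

end Transport

section Join

variable {α β α₁ α₂ β₁ β₂ : Type*} {G : Graph α β} {G₁ : Graph α₁ β₁} {G₂ : Graph α₂ β₂}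
  {d₁ : β₁} {d₂ : β₂}

theorem nonempty_iso_symm {D D' : DirectedMultigraph} (i : D.Iso D') : Nonempty (D'.Iso D) :=
  ⟨i.vertEquiv.symm, i.arcEquiv.symm, fun a => by
    obtain ⟨b, rfl⟩ := i.arcEquiv.surjective a
    simp [i.inc_eq, Prod.map_map]⟩

theorem nonempty_iso_trans {D D' D'' : DirectedMultigraph} (i : D.Iso D') (j : D'.Iso D'') :
    Nonempty (D.Iso D'') :=
  ⟨i.vertEquiv.trans j.vertEquiv, i.arcEquiv.trans j.arcEquiv, fun a => by
    simp [i.inc_eq, j.inc_eq, Prod.map_map]⟩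

theorem IsTwoSum.finite_edgeSet_left {ι₁ : β₁ → β} {ι₂ : β₂ → β}
    (h : IsTwoSum G G₁ G₂ d₁ d₂ ι₁ ι₂) (hE : E(G).Finite) : E(G₁).Finite := by
  have hfin : (ι₁ '' (E(G₁) \ {d₁})).Finite :=
    hE.subset (h.edgeSet_eq ▸ Set.subset_union_left)
  exact (hfin.of_finite_image h.injective_left.injOn).of_sdiff (Set.finite_singleton d₁)

theorem nonempty_tauThree_iso_tauThreeJoin (hE : E(G).Finite) (hG₁ : G₁.IsBispanning)
    (hG₂ : G₂.IsBispanning) (h : G.IsTwoCliqueSum G₁ G₂ d₁ d₂) :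
    Nonempty (G.tauThree.Iso (tauThreeJoin G₁ G₂ d₁ d₂)) := by
  obtain ⟨x₁, y₁, x₂, y₂, hl₁, hl₂, ⟨φ⟩⟩ := h
  obtain ⟨f, g, hφ⟩ := exists_isMultiIso φ (.inl x₁) (.inl d₁)
  have hsum := isTwoSum_twoCliqueSum hl₁ hl₂ (ne_of_isLink_of_isBispanning hG₁ hl₁)
    (ne_of_isLink_of_isBispanning hG₂ hl₂)
  have hfin := hφ.bijOn_edgeSet.image_eq ▸ hE.image g
  obtain ⟨i⟩ := hφ.nonempty_tauThree_iso
  obtain ⟨j⟩ := hsum.nonempty_iso_tauThreeJoin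
    (not_isBispanning_deleteEdges_singleton (hsum.finite_edgeSet_left hfin) hG₁ hl₁.edge_mem)
    (not_isBispanning_deleteEdges_singleton (hsum.symm.finite_edgeSet_left hfin) hG₂ hl₂.edge_mem)
  obtain ⟨j'⟩ := nonempty_iso_symm j
  exact nonempty_iso_trans i j'

end Join

section AddSeam

variable {α β : Type*} {G K : Graph α β} {x y : α}

/-- `K` together with a new edge `none` from `x` to `y`. The ends of the new edge are added to the
vertices, so that no assumption on `x` and `y` is needed. -/
def addSeam (K : Graph α β) (x y : α) : Graph α (Option β) where
  vertexSet := insert x (insert y V(K))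
  IsLink
    | some e, a, b => K.IsLink e a b
    | none, a, b => (a = x ∧ b = y) ∨ (a = y ∧ b = x)
  isLink_symm := by
    rintro (_ | e) - <;> constructor <;> intro a b h
    · exact h.symm.imp And.symm And.symm
    · exact IsLink.symm h
  eq_or_eq_of_isLink_of_isLink := by
    rintro (_ | e) a b c d h h'
    · grind
    · exact IsLink.left_eq_or_eq h h'
  left_mem_of_isLink := by
    rintro (_ | e) a b h
    · grind
    · exact .inr (.inr (IsLink.left_mem h))

theorem isLink_addSeam_none : (addSeam K x y).IsLink none x y := .inl ⟨rfl, rfl⟩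

theorem vertexSet_addSeam (hx : x ∈ V(K)) (hy : y ∈ V(K)) : V(addSeam K x y) = V(K) :=
  (Set.insert_eq_of_mem (.inr hx)).trans (Set.insert_eq_of_mem hy)

theorem edgeSet_addSeam : E(addSeam K x y) = insert none (some '' E(K)) := by
  ext (_ | e)
  · exact iff_of_true isLink_addSeam_none.edge_mem (.inl rfl)
  · rw [Set.mem_insert_iff, or_iff_right (Option.some_ne_none e),
      (Option.some_injective β).mem_set_image, edge_mem_iff_exists_isLink,
      edge_mem_iff_exists_isLink]
    rfl

theorem isMultiIso_deleteEdges_addSeam (hx : x ∈ V(K)) (hy : y ∈ V(K)) :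
    IsMultiIso K ((addSeam K x y).deleteEdges {none}) id some where
  bijOn_vertexSet := by
    rw [vertexSet_deleteEdges, vertexSet_addSeam hx hy]
    exact Set.bijOn_id _
  bijOn_edgeSet := by
    rw [edgeSet_deleteEdges, edgeSet_addSeam, Set.insert_sdiff_self_of_notMem (by simp)]
    exact (Option.some_injective β).injOn.bijOn_image
  isLink e a b hl := ⟨hl, Option.some_ne_none e⟩

theorem simple_addSeam (hK : K.Simple) (hxy : x ≠ y) (hn : ∀ e, ¬ K.IsLink e x y) :
    (addSeam K x y).Simple where
  not_isLoopAt := by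
    rintro (_ | e) a hl
    · rcases hl with hl | hl <;> grind
    · exact K.not_isLoopAt e a hl
  eq_of_isLink := by
    have not_isLink_of_none {e a b} (h : (addSeam K x y).IsLink none a b) : ¬ K.IsLink e a b := by
      rcases h with ⟨rfl, rfl⟩ | ⟨rfl, rfl⟩
      exacts [hn e, fun hl => hn e hl.symm]
    rintro (_ | e) (_ | f) a b he hf
    · rfl
    · exact absurd hf (not_isLink_of_none he)
    · exact absurd he (not_isLink_of_none hf)
    · exact congrArg some (IsLink.eq he hf)

theorem exists_le_isBispanning_of_addSeam {e : β} (hK : K ≤ G) (hx : x ∈ V(K)) (hy : y ∈ V(K))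
    (hl : G.IsLink e x y) (he : e ∉ E(K)) (hb : (addSeam K x y).IsBispanning) :
    ∃ H ≤ G, V(H) = V(K) ∧ H.IsBispanning := by
  let H := (G.restrict (insert e E(K))).induce V(K)
  have hlH : H.IsLink e x y := ⟨⟨.inl rfl, hl⟩, hx, hy⟩
  have hKH {f a b} (h : K.IsLink f a b) : H.IsLink f a b :=
    ⟨⟨.inr h.edge_mem, h.mono hK⟩, h.left_mem, h.right_mem⟩
  have hiso : IsMultiIso (addSeam K x y) H id (fun o => o.getD e) := by
    refine ⟨(vertexSet_addSeam hx hy).symm ▸ Set.bijOn_id _, ⟨?_, ?_, ?_⟩, ?_⟩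
    · rw [edgeSet_addSeam]
      rintro _ (rfl | ⟨f, hf, rfl⟩)
      · exact hlH.edge_mem
      · obtain ⟨a, b, hab⟩ := exists_isLink_of_mem_edgeSet hf
        exact (hKH hab).edge_mem
    · rw [edgeSet_addSeam]
      rintro _ (rfl | ⟨f, hf, rfl⟩) _ (rfl | ⟨f', hf', rfl⟩) heq <;>
        simp only [Option.getD_none, Option.getD_some] at heq <;> grind
    · rw [edgeSet_addSeam]
      intro f hf
      obtain ⟨a, b, hab⟩ := exists_isLink_of_mem_edgeSet hf
      rcases hab.1.1 with rfl | hfK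
      exacts [⟨none, .inl rfl, rfl⟩, ⟨some f, .inr ⟨f, hfK, rfl⟩, rfl⟩]
    · rintro (_ | f) a b hab
      · rcases hab with ⟨rfl, rfl⟩ | ⟨rfl, rfl⟩
        exacts [hlH, hlH.symm]
      · exact hKH hab
  have hHG : H ≤ G := ⟨hK.vertexSet_mono, fun _ _ _ h => h.1.2⟩
  exact ⟨H, hHG, rfl, hiso.isBispanning_iff.1 hb⟩

end AddSeam

section TwoSeparation

variable {α β : Type*} {G K L H : Graph α β} {x y : α}

/-- `G` is the union of two edge-disjoint subgraphs `K` and `L` that share exactly the two vertices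
`x` and `y`. -/
structure IsTwoSeparation (G K L : Graph α β) (x y : α) : Prop where
  ne : x ≠ y
  left_le : K ≤ G
  right_le : L ≤ G
  vertexSet_union : V(K) ∪ V(L) = V(G)
  vertexSet_inter : V(K) ∩ V(L) = {x, y}
  edgeSet_union : E(K) ∪ E(L) = E(G)
  edgeSet_disjoint : Disjoint E(K) E(L)

theorem IsTwoSeparation.symm (h : IsTwoSeparation G K L x y) : IsTwoSeparation G L K x y where
  ne := h.ne
  left_le := h.right_le
  right_le := h.left_le
  vertexSet_union := (Set.union_comm _ _).trans h.vertexSet_union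
  vertexSet_inter := (Set.inter_comm _ _).trans h.vertexSet_inter
  edgeSet_union := (Set.union_comm _ _).trans h.edgeSet_union
  edgeSet_disjoint := h.edgeSet_disjoint.symm

theorem IsTwoSeparation.mem_left (h : IsTwoSeparation G K L x y) : x ∈ V(K) ∧ y ∈ V(K) :=
  ⟨(h.vertexSet_inter.ge (.inl rfl)).1, (h.vertexSet_inter.ge (.inr rfl)).1⟩

theorem IsTwoSeparation.exists_isMultiIso (h : IsTwoSeparation G K L x y) :
    ∃ f g, IsMultiIso G
      (twoCliqueSum (addSeam K x y) (addSeam L x y) none none x y x y) f g := by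
  classical
  let f (v : α) : α ⊕ α := if v ∈ V(K) then .inl v else .inr v
  let g (e : β) : Option β ⊕ Option β := if e ∈ E(K) then .inl (some e) else .inr (some e)
  have hfK {v} (hv : v ∈ V(K)) : f v = .inl v := if_pos hv
  have hfL {v} (hv : v ∈ V(L)) : f v = glue x y x y (.inr v) := by
    have hinter := Set.ext_iff.1 h.vertexSet_inter v
    grind [glue]
  have hgK {e} (he : e ∈ E(K)) : g e = .inl (some e) := if_pos he
  have hgL {e} (he : e ∈ E(L)) : g e = .inr (some e) :=
    if_neg (Set.disjoint_right.1 h.edgeSet_disjoint he)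
  refine ⟨f, g, ?_, ?_, fun e a b hl => ?_⟩
  · rw [vertexSet_twoCliqueSum, vertexSet_addSeam h.mem_left.1 h.mem_left.2,
      vertexSet_addSeam h.symm.mem_left.1 h.symm.mem_left.2, ← h.vertexSet_union,
      ← Set.image_congr fun v hv => hfK hv, ← Set.image_congr fun v hv => hfL hv,
      ← Set.image_union]
    exact Set.InjOn.bijOn_image fun v _ w _ hvw => by grind
  · have hsdiff (M : Graph α β) : E(addSeam M x y) \ {none} = some '' E(M) := by
      rw [edgeSet_addSeam, Set.insert_sdiff_self_of_notMem (by simp)]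
    rw [edgeSet_twoCliqueSum, hsdiff, hsdiff, Set.image_image, Set.image_image,
      ← h.edgeSet_union, ← Set.image_congr fun e he => hgK he,
      ← Set.image_congr fun e he => hgL he, ← Set.image_union]
    exact Set.InjOn.bijOn_image fun e _ e' _ hee => by grind
  · have he := hl.edge_mem
    rw [← h.edgeSet_union] at he
    rcases he with he | he
    · have hlK := (h.left_le.isLink_iff he).2 hl
      rw [hgK he, twoCliqueSum_isLink_inl]
      exact ⟨Option.some_ne_none e, a, b, hlK, (hfK hlK.left_mem).symm, (hfK hlK.right_mem).symm⟩
    · have hlL := (h.right_le.isLink_iff he).2 hl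
      rw [hgL he, twoCliqueSum_isLink_inr]
      exact ⟨Option.some_ne_none e, a, b, hlL, (hfL hlL.left_mem).symm, (hfL hlL.right_mem).symm⟩

theorem not_isBispanning_of_vertexSet_ne (hG : G.IsAtomicBispanning) (hH : H ≤ G)
    (hx : x ∈ V(H)) (hy : y ∈ V(H)) (hxy : x ≠ y) (hV : V(H) ≠ V(G)) : ¬ H.IsBispanning := by
  intro hb
  rcases hG.2 H hH hb with rfl | ⟨v, rfl⟩
  · exact hV rfl
  · exact hxy (hx.trans hy.symm)

theorem IsTwoSeparation.isBispanning_addSeam (h : IsTwoSeparation G K L x y)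
    (hG : G.IsAtomicBispanning) (hK : V(K) ≠ V(G)) (hL : V(L) ≠ V(G)) :
    (addSeam K x y).IsBispanning ∧ (addSeam L x y).IsBispanning := by
  obtain ⟨f, g, hfg⟩ := h.exists_isMultiIso
  obtain ⟨p, hp⟩ := hfg.isBispanning_iff.1 hG.1
  have hsum := isTwoSum_twoCliqueSum (G₁ := addSeam K x y) (G₂ := addSeam L x y)
    isLink_addSeam_none isLink_addSeam_none h.ne h.ne
  obtain ⟨hxK, hyK⟩ := h.mem_left
  obtain ⟨hxL, hyL⟩ := h.symm.mem_left
  have hK' := not_isBispanning_of_vertexSet_ne hG h.left_le hxK hyK h.ne hK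
  have hL' := not_isBispanning_of_vertexSet_ne hG h.right_le hxL hyL h.ne hL
  rw [(isMultiIso_deleteEdges_addSeam hxK hyK).isBispanning_iff] at hK'
  rw [(isMultiIso_deleteEdges_addSeam hxL hyL).isBispanning_iff] at hL'
  obtain ⟨p₁, p₂, hp₁, hp₂, -⟩ := hsum.exists_gluePair hK' hL' hp
  exact ⟨⟨p₁, hp₁⟩, ⟨p₂, hp₂⟩⟩

theorem IsTwoSeparation.not_isLink (h : IsTwoSeparation G K L x y) (hG : G.IsAtomicBispanning)
    (hK : V(K) ≠ V(G)) (hL : V(L) ≠ V(G)) (e : β) : ¬ G.IsLink e x y := by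
  intro hl
  have not_isBispanning {H} (hH : H ≤ G) (hV : V(H) ≠ V(G)) (hx : x ∈ V(H)) (hy : y ∈ V(H)) :=
    not_isBispanning_of_vertexSet_ne hG hH hx hy h.ne hV
  obtain ⟨hbK, hbL⟩ := h.isBispanning_addSeam hG hK hL
  obtain ⟨hxK, hyK⟩ := h.mem_left
  obtain ⟨hxL, hyL⟩ := h.symm.mem_left
  by_cases he : e ∈ E(K)
  · obtain ⟨H, hH, hV, hb⟩ := exists_le_isBispanning_of_addSeam h.right_le hxL hyL hl
      (Set.disjoint_left.1 h.edgeSet_disjoint he) hbL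
    exact not_isBispanning hH (hV ▸ hL) (hV ▸ hxL) (hV ▸ hyL) hb
  · obtain ⟨H, hH, hV, hb⟩ := exists_le_isBispanning_of_addSeam h.left_le hxK hyK hl he hbK
    exact not_isBispanning hH (hV ▸ hK) (hV ▸ hxK) (hV ▸ hyK) hb

end TwoSeparation

section Cut

variable {α β : Type*} {G : Graph α β} {U : Set β} {a b c x y u v : α}

theorem Connects.exists_isLink_ne (h : Connects G U) (ha : a ∈ V(G)) (hb : b ∈ V(G))
    (hab : a ≠ b) : ∃ e ∈ U, ∃ c ≠ a, G.IsLink e a c := by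
  obtain ⟨f, hf, u, v, hl, rfl, hv⟩ := (h.2 a ha b hb).exists_isLink_of_not (· = a) rfl hab.symm
  exact ⟨f, hf, v, hv, hl⟩

theorem isBispanning_banana {e f : β} (hab : a ≠ b) (hef : e ≠ f) :
    (banana a b {e, f}).IsBispanning := by
  have isSpanningTree {g : β} (hg : g ∈ ({e, f} : Set β)) :
      (banana a b {e, f}).IsSpanningTree {g} := by
    have hl : (banana a b {e, f}).IsLink g a b := by simp [hg]
    have hr : Reach (banana a b {e, f}) {g} a b := reach_of_isLink hl rfl
    rw [isSpanningTree_iff_minimal_connects, minimal_connects_iff]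
    refine ⟨⟨⟨a, hl.left_mem⟩, ?_⟩, ?_⟩
    · rintro _ (rfl | rfl) _ (rfl | rfl)
      exacts [.refl _ _ _, hr, hr.symm, .refl _ _ _]
    · rintro _ rfl hc
      obtain ⟨g', hg', -⟩ := hc.exists_isLink_ne hl.left_mem hl.right_mem hab
      exact hg'.2 hg'.1
  exact ⟨({e}, {f}), isSpanningTree (.inl rfl), isSpanningTree (.inr rfl),
    Set.disjoint_singleton.2 hef, Set.singleton_union⟩

theorem simple_of_isAtomicBispanning (hG : G.IsAtomicBispanning) (hV : 2 < V(G).encard) :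
    G.Simple where
  not_isLoopAt e x hl := ne_of_isLink_of_isBispanning hG.1 hl rfl
  eq_of_isLink e f a b he hf := by
    by_contra hef
    have hab := ne_of_isLink_of_isBispanning hG.1 he
    have hle : banana a b {e, f} ≤ G := by
      refine ⟨Set.insert_subset he.left_mem (Set.singleton_subset_iff.2 he.right_mem), ?_⟩
      rintro g c d ⟨rfl | rfl, ⟨rfl, rfl⟩ | ⟨rfl, rfl⟩⟩
      exacts [he, he.symm, hf, hf.symm]
    refine not_isBispanning_of_vertexSet_ne hG hle (.inl rfl) (.inr rfl) hab (fun h => ?_)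
      (isBispanning_banana hab hef)
    rw [← h, vertexSet_banana, Set.encard_pair hab] at hV
    exact lt_irrefl _ hV

theorem Connects.exists_isLink_or (h : Connects G U) (hV : V(G) = {a, b, c}) (hab : a ≠ b) :
    (∃ e ∈ U, G.IsLink e a b) ∨ ∃ e ∈ U, G.IsLink e a c := by
  obtain ⟨e, he, z, hza, hl⟩ := h.exists_isLink_ne (by simp [hV]) (b := b) (by simp [hV]) hab
  have hz := hl.right_mem
  rw [hV] at hz
  rcases hz with rfl | rfl | rfl
  exacts [absurd rfl hza, .inl ⟨e, he, hl⟩, .inr ⟨e, he, hl⟩]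

theorem encard_ne_three_of_isBispanning (hG : G.IsBispanning) (hs : G.Simple) :
    V(G).encard ≠ 3 := by
  intro h3
  obtain ⟨a, b, c, hab, hac, -, hV⟩ := Set.encard_eq_three.1 h3
  obtain ⟨⟨S, T⟩, hS, hT, hST, -⟩ := hG
  have hS := (isSpanningTree_iff_minimal_connects.1 hS).prop
  have hT := (isSpanningTree_iff_minimal_connects.1 hT).prop
  have not_both {u v} (h : ∃ e ∈ S, G.IsLink e u v) (h' : ∃ e ∈ T, G.IsLink e u v) : False := by
    obtain ⟨e, he, hl⟩ := h
    obtain ⟨f, hf, hl'⟩ := h'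
    exact Set.disjoint_left.1 hST he (hl.eq hl' ▸ hf)
  have symm {U : Set β} {u v} : (∃ e ∈ U, G.IsLink e u v) → ∃ e ∈ U, G.IsLink e v u :=
    fun ⟨e, he, hl⟩ => ⟨e, he, hl.symm⟩
  have no_link {b c} (hab : a ≠ b) (hac : a ≠ c) (hV : V(G) = {a, b, c}) :
      ¬ ∃ e ∈ S, G.IsLink e a b := by
    intro hSab
    have hTac := (hT.exists_isLink_or hV hab).resolve_left (not_both hSab)
    have hTbc := (hT.exists_isLink_or (hV.trans (Set.insert_comm a b {c})) hab.symm).resolve_left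
      (not_both (symm hSab))
    have hVc : V(G) = {c, a, b} := by
      rw [hV, Set.pair_comm b c, Set.insert_comm a c]
    rcases hS.exists_isLink_or hVc hac.symm with hSca | hScb
    exacts [not_both (symm hSca) hTac, not_both (symm hScb) hTbc]
  rcases hS.exists_isLink_or hV hab with h | h
  exacts [no_link hab hac hV h, no_link hac hab (hV.trans (by rw [Set.pair_comm b c])) h]

theorem exists_not_reach_of_hasVertexConnectivity_two (hG : G.HasVertexConnectivity 2)
    (h3 : V(G).encard ≠ 3) : ∃ x ∈ V(G), ∃ y ∈ V(G), x ≠ y ∧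
      ∃ u ∈ V(G) \ {x, y}, ∃ v ∈ V(G) \ {x, y},
        ¬ Reach (G.deleteVerts {x, y}) E(G.deleteVerts {x, y}) u v := by
  obtain ⟨⟨hc, hcard, h2⟩, hmax⟩ := hG
  have h3lt : 3 < V(G).encard :=
    lt_of_le_of_ne (Order.add_one_le_of_lt hcard) h3.symm
  have not_connected : ¬ G.IsKVertexConnected 3 := fun h => absurd (hmax h) (by decide)
  simp only [Graph.IsKVertexConnected, not_and, not_forall] at not_connected
  obtain ⟨X, hXV, hX3, hX⟩ := not_connected hc h3lt
  have hX2 : X.encard = 2 :=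
    le_antisymm (Order.le_of_lt_add_one hX3) (not_lt.1 fun hlt => hX (h2 X hXV hlt))
  obtain ⟨x, y, hxy, rfl⟩ := Set.encard_eq_two.1 hX2
  refine ⟨x, hXV (.inl rfl), y, hXV (.inr rfl), hxy, ?_⟩
  by_contra! hall
  rw [isConnected_iff_connects] at hX
  refine hX ⟨?_, (vertexSet_deleteVerts G {x, y}).symm ▸ hall⟩
  rw [vertexSet_deleteVerts, Set.sdiff_nonempty]
  exact fun hsub => (hX3.trans h3lt).not_ge (Set.encard_le_encard hsub)

theorem isTwoSeparation_induce_deleteVerts {P : Set α} (hx : x ∈ V(G)) (hy : y ∈ V(G))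
    (hxy : x ≠ y) (hP : P ⊆ V(G) \ {x, y})
    (hPl : ∀ e a b, G.IsLink e a b → a ∈ P → b ∈ P ∪ {x, y}) :
    IsTwoSeparation G ((G.induce (P ∪ {x, y})).deleteEdges E(G.deleteVerts P))
      (G.deleteVerts P) x y := by
  have hle : (G.induce (P ∪ {x, y})).deleteEdges E(G.deleteVerts P) ≤ G :=
    deleteEdges_le.trans (induce_le
      (Set.union_subset (hP.trans Set.sdiff_subset) (Set.pair_subset hx hy)))
  refine ⟨hxy, hle, deleteVerts_le, ?_, ?_, ?_, ?_⟩
  · rw [vertexSet_deleteEdges, vertexSet_induce, vertexSet_deleteVerts]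
    grind
  · rw [vertexSet_deleteEdges, vertexSet_induce, vertexSet_deleteVerts]
    grind
  · refine (Set.union_subset hle.edgeSet_mono deleteVerts_le.edgeSet_mono).antisymm fun e he => ?_
    by_cases heP : e ∈ E(G.deleteVerts P)
    · exact .inr heP
    · obtain ⟨a, b, hl⟩ := exists_isLink_of_mem_edgeSet he
      have hPab : a ∈ P ∨ b ∈ P := by
        by_contra! hPab
        exact heP ((G.deleteVerts_isLink P).2 ⟨hl, hPab⟩).edge_mem
      have hab : a ∈ P ∪ {x, y} ∧ b ∈ P ∪ {x, y} := hPab.elim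
        (fun ha => ⟨.inl ha, hPl e a b hl ha⟩) fun hb => ⟨hPl e b a hl.symm hb, .inl hb⟩
      exact .inl (IsLink.edge_mem ⟨⟨hl, hab⟩, heP⟩)
  · rw [edgeSet_deleteEdges]
    exact Set.disjoint_sdiff_left

theorem exists_isTwoSeparation (hx : x ∈ V(G)) (hy : y ∈ V(G)) (hxy : x ≠ y)
    (hu : u ∈ V(G) \ {x, y}) (hv : v ∈ V(G) \ {x, y})
    (hr : ¬ Reach (G.deleteVerts {x, y}) E(G.deleteVerts {x, y}) u v) :
    ∃ K L, IsTwoSeparation G K L x y ∧ V(K) ≠ V(G) ∧ V(L) ≠ V(G) := by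
  let P : Set α := {w | Reach (G.deleteVerts {x, y}) E(G.deleteVerts {x, y}) u w}
  have hP : P ⊆ V(G) \ {x, y} := fun w hw => by
    have hwV := Reach.right_mem hw
    rw [vertexSet_deleteVerts] at hwV
    exact hwV hu
  have hPl (e a b) (hl : G.IsLink e a b) (ha : a ∈ P) : b ∈ P ∪ {x, y} := by
    by_cases hb : b ∈ ({x, y} : Set α)
    · exact .inr hb
    · have hl' : (G.deleteVerts {x, y}).IsLink e a b :=
        (G.deleteVerts_isLink _).2 ⟨hl, (hP ha).2, hb⟩
      exact .inl (Reach.trans ha (reach_of_isLink hl' hl'.edge_mem))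
  refine ⟨_, _, isTwoSeparation_induce_deleteVerts hx hy hxy hP hPl, fun h => ?_, fun h => ?_⟩
  · exact (h.ge hv.1).elim hr hv.2
  · rw [vertexSet_deleteVerts] at h
    exact (h.ge hu.1).2 (.refl _ _ _)

theorem exists_isTwoCliqueSum_of_isAtomicBispanning (hG : G.IsAtomicBispanning)
    (hconn : G.HasVertexConnectivity 2) : ∃ (G₁ G₂ : Graph α (Option β)) (d₁ d₂ : Option β),
      G₁.Simple ∧ G₁.IsBispanning ∧ G₂.Simple ∧ G₂.IsBispanning ∧
        G.IsTwoCliqueSum G₁ G₂ d₁ d₂ := by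
  have hs := simple_of_isAtomicBispanning hG hconn.1.2.1
  obtain ⟨x, hx, y, hy, hxy, u, hu, v, hv, hr⟩ :=
    exists_not_reach_of_hasVertexConnectivity_two hconn (encard_ne_three_of_isBispanning hG.1 hs)
  obtain ⟨K, L, h, hK, hL⟩ := exists_isTwoSeparation hx hy hxy hu hv hr
  have hn := h.not_isLink hG hK hL
  obtain ⟨hbK, hbL⟩ := h.isBispanning_addSeam hG hK hL
  obtain ⟨f, g, hfg⟩ := h.exists_isMultiIso
  have simple_addSeam_of_le {M} (hM : M ≤ G) : (addSeam M x y).Simple :=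
    simple_addSeam (hs.anti hM) hxy fun e hl => hn e (hl.mono hM)
  exact ⟨addSeam K x y, addSeam L x y, none, none, simple_addSeam_of_le h.left_le, hbK,
    simple_addSeam_of_le h.right_le, hbL, x, y, x, y, isLink_addSeam_none, isLink_addSeam_none,
    ⟨hfg.toMultiIso⟩⟩

end Cut

end Bispanning

theorem mainTheorem2_general {α β : Type*} (G : Graph α β) :
    (G.IsAtomicBispanning → G.HasVertexConnectivity 2 →
      ∃ (G₁ G₂ : Graph α (Option β)) (d₁ d₂ : Option β),
        G₁.Simple ∧ G₁.IsBispanning ∧ G₂.Simple ∧ G₂.IsBispanning ∧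
          G.IsTwoCliqueSum G₁ G₂ d₁ d₂) ∧
    (E(G).Finite →
      ∀ {α₁ α₂ β₁ β₂ : Type*} (G₁ : Graph α₁ β₁) (G₂ : Graph α₂ β₂) (d₁ : β₁) (d₂ : β₂),
        G₁.IsBispanning → G₂.IsBispanning → G.IsTwoCliqueSum G₁ G₂ d₁ d₂ →
        Nonempty (G.tauThree.Iso (Graph.tauThreeJoin G₁ G₂ d₁ d₂))) :=
  ⟨Bispanning.exists_isTwoCliqueSum_of_isAtomicBispanning,
    fun hE _ _ _ _ _ _ _ _ => Bispanning.nonempty_tauThree_iso_tauThreeJoin hE⟩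

theorem mainTheorem2 {α β : Type*} (G : Graph α β) (hV : V(G).Finite) (hE : E(G).Finite)
    (hG : G.IsAtomicBispanning) (hconn : G.HasVertexConnectivity 2) :
    (∃ (G₁ G₂ : Graph α (Option β)) (d₁ d₂ : Option β),
      G₁.Simple ∧ G₁.IsBispanning ∧ G₂.Simple ∧ G₂.IsBispanning ∧
        G.IsTwoCliqueSum G₁ G₂ d₁ d₂) ∧
    ∀ {α₁ α₂ β₁ β₂ : Type*} (G₁ : Graph α₁ β₁) (G₂ : Graph α₂ β₂) (d₁ : β₁) (d₂ : β₂),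
      G₁.Simple → G₁.IsBispanning → G₂.Simple → G₂.IsBispanning →
      G.IsTwoCliqueSum G₁ G₂ d₁ d₂ →
      Nonempty (G.tauThree.Iso (Graph.tauThreeJoin G₁ G₂ d₁ d₂)) := by
  exact (mainTheorem2_general G).imp (fun h => h hG hconn)
    fun h _ _ _ _ G₁ G₂ d₁ d₂ _ h₁ _ h₂ => h hE G₁ G₂ d₁ d₂ h₁ h₂
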